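/- Let $M$ be a smooth $n$-manifold and $X$ a Morse–Smale vector field on $M$, that is, a smooth complete vector field such that: 1. every rest point $x$ is hyperbolic (the linearization of $X$ at $x$ has no eigenvalue with zero real part); its index $i(x)$ is the number, with multiplicity, of eigenvalues with positive real part, and the unstable set $W^-_x$ and the stable set $W^+_x$ (the points whose trajectory tends to $x$ as $t\to-\infty$, respectively $t\to+\infty$) are smooth manifolds, diffeomorphic to $\mathbb R^{i(x)}$ and $\mathbb R^{n-i(x)}$ and injectively immersed in $M$; 2. every periodic trajectory is hyperbolic in the directions normal to it; 3. for all rest points $x,y$ the immersed manifolds $W^-_x$ and $W^+_y$ are transversal. Let $x>y$ be rest points, i.e. $x\ne y$ and some trajectory goes from $x$ to $y$, and let $\mathcal M(x,y)=W^-_x\cap W^+_y$ with its structure of a manifold of dimension $i(x)-i(y)$, as the transversal intersection (fibre product over $M$) of the two immersed manifolds. Let $o^-_x$ and $o^-_y$ be orientations of the manifolds $W^-_x$ and $W^-_y$. Denote by $\tau^-_x,\tau^+_y,\tau,T$ the restrictions to $\mathcal M(x,y)$ of the tangent bundles of $W^-_x$, $W^+_y$, $\mathcal M(x,y)$, $M$,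 and write $o=o_1\cdot o_2$ for the orientation of $E$ defined by orientations $o_1,o_2$ of $E_1,E_2$ through a short exact sequence $0\to E_1\to E\to E_2\to 0$ (a positive frame of $E_1$ followed by a lift of a positive frame of $E_2$ is positive). Since $W^+_y$ is contractible and $T_yM=T_yW^+_y\oplus T_yW^-_y$, the orientation $o^-_y$ of $T_yW^-_y$ extends uniquely to an orientation, again denoted $o^-_y$, of the normal bundle $\nu$ of $W^+_y$ in $M$. Then the bundle $T$ over $\mathcal M(x,y)$ is orientable, and each orientation $o$ of $T$ determines exactly one orientation $o_\tau$ of $\mathcal M(x,y)$ by the two conditions $$o^+_y\cdot o^-_y=o,\qquad o_\tau\cdot o=o^-_x\cdot o^+_y,$$ where $o^+_y$ is an orientation of $\tau^+_y$, the first product is taken in $0\to\tau^+_y\to T\to\nu\to0$, the right-hand side of the second one is the product orientation of $\tau^-_x\oplus\tau^+_y$, and its left-hand side is taken in the short exact sequence $0\to\tau\to\tau^-_x\oplus\tau^+_y\to T\to0$ with the maps $v\mapsto(v,v)$ and $(u,w)\mapsto w-u$. Moreover $o_\tau$ does not depend on $o$: it is the same orientation $o_{x,y}$ of $\mathcal M(x,y)$,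 induced by $o^-_x$ and $o^-_y$, for all orientations $o$ of $T$. -/

import Mathlib

open scoped Manifold ContDiff Topology

noncomputable section

namespace MorseSmale

/-- `ℝᵏ` with its Euclidean structure. -/
abbrev Euc (k : ℕ) : Type := EuclideanSpace ℝ (Fin k)

/-! ### Orientations of vector spaces and of families of vector spaces -/

section Orientations

/-- The sign of a basis with respect to an orientation: `1` if the basis represents the
orientation, `-1` if it represents the opposite one. -/
def frameSign {V : Type*} [AddCommGroup V] [Module ℝ V] {d : ℕ}
    (o : Orientation ℝ V (Fin d)) (b : Module.Basis (Fin d) ℝ V) : ℤˣ :=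
  open Classical in if b.orientation = o then 1 else -1

/-- `f` is a linear isomorphism that carries the orientation `o` of `V` to the orientation `o'`
of `W`. -/
def IsPushforward {V W : Type*} [AddCommGroup V] [Module ℝ V] [AddCommGroup W] [Module ℝ W]
    {d : ℕ} (f : V →ₗ[ℝ] W) (o : Orientation ℝ V (Fin d)) (o' : Orientation ℝ W (Fin d)) : Prop :=
  ∃ e : V ≃ₗ[ℝ] W, (e : V →ₗ[ℝ] W) = f ∧ Orientation.map (Fin d) e o = o'

/-- `0 → E₁ → E → E₂ → 0` (with the maps `i` and `π`) is a short exact sequence and `o = o₁ · o₂`: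
a basis of `E` that consists of the image of a basis of `E₁` followed by a lift of a basis of `E₂`
has as its sign the product of the signs of these two bases. -/
structure IsProductOrientation {E₁ E E₂ : Type*} [AddCommGroup E₁] [Module ℝ E₁]
    [AddCommGroup E] [Module ℝ E] [AddCommGroup E₂] [Module ℝ E₂] {d₁ d d₂ : ℕ}
    (i : E₁ →ₗ[ℝ] E) (π : E →ₗ[ℝ] E₂) (o₁ : Orientation ℝ E₁ (Fin d₁))
    (o₂ : Orientation ℝ E₂ (Fin d₂)) (o : Orientation ℝ E (Fin d)) : Prop where
  injective : Function.Injective i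
  exact : Function.Exact i π
  surjective : Function.Surjective π
  sign : ∃ h : d₁ + d₂ = d, ∀ (b₁ : Module.Basis (Fin d₁) ℝ E₁) (b₂ : Module.Basis (Fin d₂) ℝ E₂)
    (b : Module.Basis (Fin d) ℝ E),
    (∀ j : Fin d₁, b (Fin.cast h (Fin.castAdd d₂ j)) = i (b₁ j)) →
    (∀ j : Fin d₂, π (b (Fin.cast h (Fin.natAdd d₁ j))) = b₂ j) →
    frameSign o b = frameSign o₁ b₁ * frameSign o₂ b₂

/-- An orientation of a vector bundle of rank `d` over `B` with fibres `F b`, where `IsCts s b`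
says that the section `s` is continuous at the point `b`: an orientation of every fibre such that
near every point of `B` there is a continuous frame which represents it, or represents its
opposite, at all nearby points. (Both alternatives are needed only when `d = 0`.) -/
@[ext]
structure BundleOrientation {B : Type*} [TopologicalSpace B] (F : B → Type*)
    [∀ b, AddCommGroup (F b)] [∀ b, Module ℝ (F b)] (IsCts : (∀ b, F b) → B → Prop) (d : ℕ) where
  /-- The orientation of each fibre. -/
  orient : ∀ b, Orientation ℝ (F b) (Fin d)
  continuous : ∀ b₀ : B, ∃ (s : Fin d → ∀ b, F b) (ε : ℤˣ), ∀ᶠ b in 𝓝 b₀,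
    (∀ j, IsCts (s j) b) ∧
      ∃ e : Module.Basis (Fin d) ℝ (F b), (∀ j, e j = s j b) ∧ frameSign (orient b) e = ε

/-- An orientation of the trivial bundle with fibre `V` over `B`. -/
abbrev TrivialBundleOrientation (B V : Type*) [TopologicalSpace B] [AddCommGroup V] [Module ℝ V]
    [TopologicalSpace V] (d : ℕ) :=
  BundleOrientation (fun _ : B => V) (fun s b => ContinuousAt s b) d

/-- The tangent space at `q` of a subset `S` of a normed space (in the applications, of a smooth
submanifold): the span of the velocities at `q` of the smooth curves in `S` through `q`. -/
def tangentAt {V : Type*} [NormedAddCommGroup V] [NormedSpace ℝ V] (S : Set V) (q : V) :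
    Submodule ℝ V :=
  Submodule.span ℝ {v | ∃ c : ℝ → V, ContDiffAt ℝ ∞ c 0 ∧ (∀ᶠ t in 𝓝 0, c t ∈ S) ∧ c 0 = q ∧
    deriv c 0 = v}

/-- An orientation of the `d`-dimensional submanifold `S` of a normed space, i.e. of its tangent
bundle. -/
abbrev SubmanifoldOrientation {V : Type*} [NormedAddCommGroup V] [NormedSpace ℝ V] (S : Set V)
    (d : ℕ) :=
  BundleOrientation (fun q : S => tangentAt S (q : V))
    (fun s q => ContinuousAt (fun q' => (s q' : V)) q) d

end Orientations

variable {n : ℕ} {M : Type*} [TopologicalSpace M] [ChartedSpace (Euc n) M]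
  [IsManifold (𝓡 n) ∞ M]

/-- An orientation of the tangent bundle of `M` along a map `f : B → M`, i.e. of `f^* TM`. -/
abbrev TangentOrientationAlong {B : Type*} [TopologicalSpace B] (f : B → M) :=
  BundleOrientation (fun b => TangentSpace (𝓡 n) (f b))
    (fun s b => ContinuousAt (fun b' => (⟨f b', s b'⟩ : TangentBundle (𝓡 n) M)) b) n

/-! ### Cells: subsets of `M` that are injectively immersed copies of `ℝᵏ` -/

/-- A smooth structure on the subset `W` of `M` that makes it a manifold diffeomorphic to `ℝᵏ`
whose inclusion in `M` is an injective immersion; it is given by a parametrization. -/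
structure ImmersedCell (n : ℕ) {M : Type*} [TopologicalSpace M] [ChartedSpace (Euc n) M]
    (k : ℕ) (W : Set M) where
  /-- The injective immersion. -/
  toFun : Euc k → M
  smooth : ContMDiff (𝓡 k) (𝓡 n) ∞ toFun
  injective : Function.Injective toFun
  immersion : ∀ a, Function.Injective (mfderiv (𝓡 k) (𝓡 n) toFun a)
  range_eq : Set.range toFun = W

namespace ImmersedCell

variable {k l : ℕ} {W W' : Set M}

/-- The differential of the immersion at `a`. (As everywhere in Mathlib, the tangent space of `M`
at `p` is `ℝⁿ` through the preferred chart at `p`, so for cells `i`, `j` with `i a = j b` the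
differentials at `a` and at `b` have values in the same tangent space.) -/
def diff (i : ImmersedCell n k W) (a : Euc k) : Euc k →ₗ[ℝ] Euc n :=
  (mfderiv (𝓡 k) (𝓡 n) i.toFun a : Euc k →L[ℝ] Euc n).toLinearMap

/-- The tangent space of the cell at the point with parameter `a`, inside the tangent space
of `M`. -/
def tangent (i : ImmersedCell n k W) (a : Euc k) : Submodule ℝ (Euc n) :=
  LinearMap.range (i.diff a)

/-- Two immersed cells are transversal: wherever they meet, their tangent spaces span that
of `M`. -/
def Transversal (i : ImmersedCell n k W) (j : ImmersedCell n l W') : Prop :=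
  ∀ a b, i.toFun a = j.toFun b → i.tangent a ⊔ j.tangent b = ⊤

/-- An orientation of the cell, as a manifold (its tangent bundle is `ℝᵏ × ℝᵏ`). -/
abbrev CellOrientation (_i : ImmersedCell n k W) := TrivialBundleOrientation (Euc k) (Euc k) k

/-- An orientation of the normal bundle `TM|_W / TW` of the cell, of rank `d`. A section of it is
continuous where it lifts, locally, to a continuous section of `TM|_W`. -/
abbrev NormalOrientation (i : ImmersedCell n k W) (d : ℕ) :=
  BundleOrientation (fun b : Euc k => Euc n ⧸ i.tangent b)
    (fun s b => ∃ t : ∀ b', TangentSpace (𝓡 n) (i.toFun b'),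
      ContinuousAt (fun b' => (⟨i.toFun b', t b'⟩ : TangentBundle (𝓡 n) M)) b ∧
        ∀ᶠ b' in 𝓝 b, (i.tangent b').mkQ (t b') = s b') d

/-- The intersection of two immersed cells with its manifold structure: the submanifold
`{(a, b) | i a = j b}` of `ℝᵏ × ℝˡ`, mapped bijectively to `W ∩ W'` by `(a, b) ↦ i a = j b`. -/
def inter (i : ImmersedCell n k W) (j : ImmersedCell n l W') : Set (Euc k × Euc l) :=
  {q | i.toFun q.1 = j.toFun q.2}

/-- The inclusion in `M` of the intersection of two cells. -/
def interMap (i : ImmersedCell n k W) (j : ImmersedCell n l W') (q : i.inter j) : M :=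
  i.toFun (q : Euc k × Euc l).1

/-- The linear map `(u, w) ↦ w - u` from `TW ⊕ TW'` to `TM`, at a point of the intersection of the
two cells. Its kernel is the tangent space of the intersection if the cells are transversal. -/
def interDiff (i : ImmersedCell n k W) (j : ImmersedCell n l W') (q : i.inter j) :
    Euc k × Euc l →ₗ[ℝ] Euc n :=
  j.diff (q : Euc k × Euc l).2 ∘ₗ LinearMap.snd ℝ (Euc k) (Euc l) -
    i.diff (q : Euc k × Euc l).1 ∘ₗ LinearMap.fst ℝ (Euc k) (Euc l)

end ImmersedCell

/-! ### The dynamics of a vector field -/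

/-- `φ` is the (global) flow of the vector field `X`. -/
def IsFlow (X : ∀ p : M, TangentSpace (𝓡 n) p) (φ : ℝ → M → M) : Prop :=
  ∀ p, φ 0 p = p ∧ IsMIntegralCurve (I := 𝓡 n) (fun t => φ t p) X

/-- The unstable set of `x`: the points whose trajectory tends to `x` as `t → -∞`. -/
def unstableSet (X : ∀ p : M, TangentSpace (𝓡 n) p) (x : M) : Set M :=
  {p | ∃ γ : ℝ → M, γ 0 = p ∧ IsMIntegralCurve (I := 𝓡 n) γ X ∧
    Filter.Tendsto γ Filter.atBot (𝓝 x)}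

/-- The stable set of `x`: the points whose trajectory tends to `x` as `t → +∞`. -/
def stableSet (X : ∀ p : M, TangentSpace (𝓡 n) p) (x : M) : Set M :=
  {p | ∃ γ : ℝ → M, γ 0 = p ∧ IsMIntegralCurve (I := 𝓡 n) γ X ∧
    Filter.Tendsto γ Filter.atTop (𝓝 x)}

/-- The set `ℳ(x, y)` of the points on the trajectories from `x` to `y`. -/
def connectingSet (X : ∀ p : M, TangentSpace (𝓡 n) p) (x y : M) : Set M :=
  unstableSet X x ∩ stableSet X y

/-- The relation `x > y` between rest points: they are distinct and some trajectory goes from `x`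
to `y`. -/
def Above (X : ∀ p : M, TangentSpace (𝓡 n) p) (x y : M) : Prop :=
  x ≠ y ∧ (connectingSet X x y).Nonempty

/-- The complex eigenvalues of a real endomorphism, with algebraic multiplicity. -/
def complexEigenvalues {V : Type*} [AddCommGroup V] [Module ℝ V] [FiniteDimensional ℝ V]
    (L : V →ₗ[ℝ] V) : Multiset ℂ :=
  (L.charpoly.map (algebraMap ℝ ℂ)).roots

/-- The linearization of the vector field `X` at a rest point `x`: the derivative at `x` of the
coordinate expression of `X` in the preferred chart at `x`. -/
def linearization (X : ∀ p : M, TangentSpace (𝓡 n) p) (x : M) : Euc n →ₗ[ℝ] Euc n :=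
  (fderiv ℝ (fun u : Euc n =>
    (trivializationAt (Euc n) (TangentSpace (𝓡 n)) x
      (⟨(extChartAt (𝓡 n) x).symm u, X ((extChartAt (𝓡 n) x).symm u)⟩ :
        TangentBundle (𝓡 n) M)).2) (extChartAt (𝓡 n) x x)).toLinearMap

/-- The rest point `x` is hyperbolic. -/
def IsHyperbolic (X : ∀ p : M, TangentSpace (𝓡 n) p) (x : M) : Prop :=
  ∀ z ∈ complexEigenvalues (linearization X x), z.re ≠ 0

/-- The index of a rest point: the number, with multiplicity, of the eigenvalues of the
linearization with positive real part (the dimension of the unstable manifold). -/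
def index (X : ∀ p : M, TangentSpace (𝓡 n) p) (x : M) : ℕ :=
  open Classical in (complexEigenvalues (linearization X x)).countP (fun z => 0 < z.re)

/-- The differential of `f : M → M` at a fixed point `p`, as an endomorphism of the tangent space
of `M` at `p`. -/
def selfDiff (f : M → M) (p : M) : Euc n →ₗ[ℝ] Euc n :=
  (mfderiv (𝓡 n) (𝓡 n) f p : Euc n →L[ℝ] Euc n).toLinearMap

/-- Morse–Smale vector fields: smooth and complete, with hyperbolic rest points, with periodic
trajectories that are hyperbolic in the normal directions (the differential of the flow over a
period has the eigenvalue in the direction of the trajectory as its only eigenvalue on the unit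
circle), and with unstable manifolds of rest points transversal to stable manifolds of rest
points. -/
structure IsMorseSmale (X : ∀ p : M, TangentSpace (𝓡 n) p) : Prop where
  smooth : ContMDiff (𝓡 n) ((𝓡 n).prod (𝓡 n)) ∞
    (fun p => (⟨p, X p⟩ : TangentBundle (𝓡 n) M))
  complete : ∃ φ, IsFlow X φ
  hyperbolic_rest : ∀ x, X x = 0 → IsHyperbolic X x
  hyperbolic_periodic : ∀ φ, IsFlow X φ → ∀ (p : M) (T : ℝ), 0 < T → φ T p = p → X p ≠ 0 →
    open Classical in
    (complexEigenvalues (selfDiff (n := n) (φ T) p)).countP (fun z => ‖z‖ = 1) = 1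
  transversal : ∀ x y, X x = 0 → X y = 0 →
    ∀ (Wu : ImmersedCell n (index X x) (unstableSet X x))
      (Ws : ImmersedCell n (n - index X y) (stableSet X y)), Wu.Transversal Ws

/-! ### The induced orientation -/

section Induced

variable {X : ∀ p : M, TangentSpace (𝓡 n) p} {x y : M}

/-- The orientation `oτ` of `ℳ(x, y) = W⁻ₓ ∩ W⁺_y` is the one induced by the orientations `ox`
of `W⁻ₓ` and `oy` of `W⁻_y` with the help of the orientation `o` of `TM` along `ℳ(x, y)`.

* `ν`, written `o⁻_y` along `W⁺_y`, is the orientation of the normal bundle of the (contractible)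
  manifold `W⁺_y` which at `y`, where the normal space of `W⁺_y` is the tangent space of `W⁻_y`,
  is the given orientation `oy`.
* `oplus = o⁺_y` is the orientation of the tangent bundle of `W⁺_y` along `ℳ(x, y)` with
  `o⁺_y · o⁻_y = o`.
* `oτ · o = ox · o⁺_y` through the short exact sequence `0 → τ → τ⁻ₓ ⊕ τ⁺_y → T → 0` of the
  transversal intersection, with the maps `v ↦ (v, v)` and `(u, w) ↦ w - u`. -/
def IsInducedOrientation
    (Wx : ImmersedCell n (index X x) (unstableSet X x))
    (Wy : ImmersedCell n (index X y) (unstableSet X y))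
    (Wy' : ImmersedCell n (n - index X y) (stableSet X y))
    (ox : Wx.CellOrientation) (oy : Wy.CellOrientation)
    (o : TangentOrientationAlong (n := n) (Wx.interMap Wy'))
    (oτ : SubmanifoldOrientation (Wx.inter Wy') (index X x - index X y)) : Prop :=
  ∃ ν : Wy'.NormalOrientation (index X y),
    (∀ a b, Wy.toFun a = y → Wy'.toFun b = y →
      IsPushforward ((Wy'.tangent b).mkQ ∘ₗ Wy.diff a) (oy.orient a) (ν.orient b)) ∧
    ∃ oplus : TrivialBundleOrientation (Wx.inter Wy') (Euc (n - index X y)) (n - index X y),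
      ∀ q : Wx.inter Wy',
        IsProductOrientation (E := Euc n) (Wy'.diff q.1.2) (Wy'.tangent q.1.2).mkQ
          (oplus.orient q) (ν.orient q.1.2) (o.orient q) ∧
        ∃ oE : Orientation ℝ (Euc (index X x) × Euc (n - index X y))
            (Fin (index X x + (n - index X y))),
          IsProductOrientation (LinearMap.inl ℝ _ _) (LinearMap.snd ℝ _ _)
            (ox.orient q.1.1) (oplus.orient q) oE ∧
          IsProductOrientation (E₂ := Euc n) (tangentAt (Wx.inter Wy') q.1).subtype
            (Wx.interDiff Wy' q) (oτ.orient q) (o.orient q) oE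

end Induced

end MorseSmale

end

/-! The algebra is fibrewise. Relative to a fixed product orientation, `o = o₁ · o₂` becomes an
equation between signs in `ℤˣ` (`IsProductOrientation.iff_signs`). Replacing `o` by `-o` at a point
replaces `o⁺` by `-o⁺` in the first condition; in the second one the right-hand side and the factor
`o` on the left then both change sign, so `oτ` stays. `isInducedAt_iff` makes this precise. If `oN`
is the orientation of `TM` along `W⁺_y` for which (standard orientation of the cell) · `ν` = `oN`,
the two conditions say that `o⁺` has the sign of `oN` times that of `o`, and that `τ` is one
reference orientation `τ'` not involving `o`.

The rest is continuity. The space `T_p M` is `ℝⁿ` through the preferred chart at `p`, which jumps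
with `p`; so continuity of an orientation along a map is expressed by the sign of the standard
basis, corrected by the sign of the coordinate change to a fixed chart (`IsSignContinuousAt`).
Orientations of the normal bundle of a cell correspond to orientations of `TM` along it. As `ℝˡ` is
connected, one is determined by its value at a point (`normalOrientation_eq_of_eq_at`). As `ℝˡ` is
simply connected, the cell lifts to the orientation double cover (`exists_orientation_along`); this
yields the extension from `y` (`exists_normalOrientation`) and the orientability of `T`.

By transversality the intersection is locally a regular level set, with the kernel of `(u, w) ↦ w -
u` as tangent space (`tangentAt_inter`). Continuous frames of this kernel, completed by lifts of a
chart frame (`exists_local_frame`), show that `τ'` is continuous (`interOrientationOfSigns`). -/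

noncomputable section

namespace MorseSmale

/-! ### Signs of bases -/

section Signs

/-- The sign of a real number, with the value `-1` at `0`. -/
def unitSign (r : ℝ) : ℤˣ := if 0 < r then 1 else -1

theorem unitSign_mul {r s : ℝ} (hr : r ≠ 0) (hs : s ≠ 0) :
    unitSign (r * s) = unitSign r * unitSign s := by
  unfold unitSign
  rcases lt_or_gt_of_ne hr with h | h <;> rcases lt_or_gt_of_ne hs with h' | h'
  · simp [h.not_gt, h'.not_gt, mul_pos_of_neg_of_neg h h']
  · simp [h.not_gt, h', (mul_neg_of_neg_of_pos h h').not_gt]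
  · simp [h, h'.not_gt, (mul_neg_of_pos_of_neg h h').not_gt]
  · simp [h, h', mul_pos h h']

theorem continuousAt_unitSign {r : ℝ} (hr : r ≠ 0) : ContinuousAt unitSign r := by
  refine (continuousAt_const (y := unitSign r)).congr ?_
  rcases lt_or_gt_of_ne hr with h | h
  · filter_upwards [gt_mem_nhds h] with s hs
    simp [unitSign, h.not_gt, hs.not_gt]
  · filter_upwards [lt_mem_nhds h] with s hs
    simp [unitSign, h, hs]

/-- A function with values in `ℤˣ` is continuous at a point where it is locally constant. -/
theorem continuousAt_units_iff {B : Type*} [TopologicalSpace B] {g : B → ℤˣ} {b₀ : B} :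
    ContinuousAt g b₀ ↔ ∃ ε, ∀ᶠ b in 𝓝 b₀, g b = ε := by
  refine ⟨fun h => ⟨g b₀, ?_⟩, fun ⟨ε, h⟩ => ?_⟩
  · have := h.eventually (show ∀ᶠ z in 𝓝 (g b₀), z = g b₀ by simp [nhds_discrete])
    exact this
  · exact (continuousAt_const (y := ε)).congr (h.mono fun _ hb => hb.symm)

theorem units_eq_of_mul_eq_one {a b : ℤˣ} (h : a * b = 1) : a = b := by
  rwa [mul_eq_one_iff_eq_inv, Int.units_inv_eq_self] at h

variable {V : Type*} [AddCommGroup V] [Module ℝ V] {d : ℕ}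

theorem frameSign_neg (o : Orientation ℝ V (Fin d)) (b : Module.Basis (Fin d) ℝ V) :
    frameSign (-o) b = -frameSign o b := by
  unfold frameSign
  rcases b.orientation_eq_or_eq_neg o with h | h
  · subst h
    simp [Module.Ray.ne_neg_self]
  · subst h
    have : b.orientation ≠ -b.orientation := Module.Ray.ne_neg_self _
    have h2 : b.orientation = - -b.orientation :=
      (neg_neg (G := Module.Ray ℝ (V [⋀^Fin d]→ₗ[ℝ] ℝ)) b.orientation).symm
    rw [if_pos h2, if_neg this]
    rfl

theorem frameSign_orientation (b : Module.Basis (Fin d) ℝ V) : frameSign b.orientation b = 1 := by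
  simp [frameSign]

/-- The orientation for which a given basis has a given sign. -/
theorem exists_frameSign_eq (b : Module.Basis (Fin d) ℝ V) (ε : ℤˣ) :
    ∃ o : Orientation ℝ V (Fin d), frameSign o b = ε := by
  rcases Int.units_eq_one_or ε with rfl | rfl
  · exact ⟨b.orientation, frameSign_orientation b⟩
  · exact ⟨-b.orientation, by rw [frameSign_neg, frameSign_orientation]⟩

theorem orientation_ext (b : Module.Basis (Fin d) ℝ V) {o o' : Orientation ℝ V (Fin d)}
    (h : frameSign o b = frameSign o' b) : o = o' := by
  rcases b.orientation_eq_or_eq_neg o with rfl | rfl <;>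
    rcases b.orientation_eq_or_eq_neg o' with rfl | rfl <;>
    simp_all [frameSign_neg, frameSign_orientation]

theorem basis_det_ne_zero (b b' : Module.Basis (Fin d) ℝ V) : b.det b' ≠ 0 :=
  (b.isUnit_det b').ne_zero

/-- The effect of a change of basis on signs. -/
theorem frameSign_change (o : Orientation ℝ V (Fin d)) (b b' : Module.Basis (Fin d) ℝ V) :
    frameSign o b' = frameSign o b * unitSign (b.det b') := by
  have key : frameSign b.orientation b' = unitSign (b.det b') := by
    unfold frameSign unitSign
    have := b.orientation_eq_iff_det_pos b'
    by_cases h : 0 < b.det b'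
    · simp [h, (this.2 h).symm]
    · have h' : ¬ b'.orientation = b.orientation := fun e => h (this.1 e.symm)
      simp [h, h']
  rcases b.orientation_eq_or_eq_neg o with rfl | rfl
  · rw [key, frameSign_orientation, one_mul]
  · rw [frameSign_neg, frameSign_neg, key, frameSign_orientation, neg_one_mul]

theorem frameSign_mul_frameSign_eq (o o' : Orientation ℝ V (Fin d))
    (b b' : Module.Basis (Fin d) ℝ V) :
    frameSign o b * frameSign o' b = frameSign o b' * frameSign o' b' := by
  rw [frameSign_change o b b', frameSign_change o' b b', mul_mul_mul_comm,
    Int.units_mul_self (unitSign _), mul_one]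

end Signs

/-! ### Product orientations -/

section Product

variable {E₁ E E₂ : Type*} [AddCommGroup E₁] [Module ℝ E₁] [AddCommGroup E] [Module ℝ E]
  [AddCommGroup E₂] [Module ℝ E₂] {d₁ d d₂ : ℕ} {i : E₁ →ₗ[ℝ] E} {π : E →ₗ[ℝ] E₂}

/-- The basis `b` of `E` consists of the image of the basis `b₁` of `E₁` followed by a lift of the
basis `b₂` of `E₂`. -/
def IsAdapted (i : E₁ →ₗ[ℝ] E) (π : E →ₗ[ℝ] E₂) (h : d₁ + d₂ = d) (b₁ : Module.Basis (Fin d₁) ℝ E₁)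
    (b₂ : Module.Basis (Fin d₂) ℝ E₂) (b : Module.Basis (Fin d) ℝ E) : Prop :=
  (∀ j : Fin d₁, b (Fin.cast h (Fin.castAdd d₂ j)) = i (b₁ j)) ∧
    ∀ j : Fin d₂, π (b (Fin.cast h (Fin.natAdd d₁ j))) = b₂ j

/-- A basis of `E₁` and a lift to `E` of a basis of `E₂` form a basis of `E`. -/
theorem exists_adapted_of_lift (hi : Function.Injective i) (hex : Function.Exact i π)
    (h : d₁ + d₂ = d) (b₁ : Module.Basis (Fin d₁) ℝ E₁) (b₂ : Module.Basis (Fin d₂) ℝ E₂)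
    (t : Fin d₂ → E) (ht : ∀ j, π (t j) = b₂ j) :
    ∃ b : Module.Basis (Fin d) ℝ E, IsAdapted i π h b₁ b₂ b ∧
      (∀ j, b (Fin.cast h (Fin.natAdd d₁ j)) = t j) := by
  -- The lift defines a section of `π`, which splits the sequence: `E₁ × E₂ ≃ E`.
  set s : E₂ →ₗ[ℝ] E := b₂.constr ℝ t with hs
  have hπs : ∀ w, π (s w) = w := fun w => by
    have : π ∘ₗ s = LinearMap.id := b₂.ext fun j => by simp [hs, ht]
    exact LinearMap.congr_fun this w
  let T : E₁ × E₂ →ₗ[ℝ] E := i.coprod s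
  have hT : Function.Bijective T := by
    constructor
    · refine (injective_iff_map_eq_zero T).2 fun p hp => ?_
      have h0 : i p.1 + s p.2 = 0 := by simpa [T] using hp
      have h2 : p.2 = 0 := by
        have := congrArg π h0
        simpa [hex.apply_apply_eq_zero, hπs] using this
      have h1 : p.1 = 0 := hi (by simpa [h2] using h0)
      exact Prod.ext h1 h2
    · intro x
      obtain ⟨u, hu⟩ := (hex (x - s (π x))).1 (by simp [hπs])
      exact ⟨(u, π x), by simp [T, hu]⟩
  let e := LinearEquiv.ofBijective T hT
  refine ⟨((b₁.prod b₂).map e).reindex (finSumFinEquiv.trans (finCongr h)), ⟨?_, ?_⟩, ?_⟩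
  all_goals
    subst h
    intro j
    simp [e, T, hs, ht]

theorem exists_adapted (hi : Function.Injective i) (hex : Function.Exact i π)
    (hπ : Function.Surjective π) (h : d₁ + d₂ = d) (b₁ : Module.Basis (Fin d₁) ℝ E₁)
    (b₂ : Module.Basis (Fin d₂) ℝ E₂) :
    ∃ b : Module.Basis (Fin d) ℝ E, IsAdapted i π h b₁ b₂ b := by
  choose t ht using fun j => hπ (b₂ j)
  obtain ⟨b, hb, -⟩ := exists_adapted_of_lift hi hex h b₁ b₂ t ht
  exact ⟨b, hb⟩

/-- The determinant of the change between two adapted bases. -/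
theorem IsAdapted.det_eq (hex : Function.Exact i π) {h : d₁ + d₂ = d}
    {b₁ c₁ : Module.Basis (Fin d₁) ℝ E₁} {b₂ c₂ : Module.Basis (Fin d₂) ℝ E₂}
    {b c : Module.Basis (Fin d) ℝ E} (hb : IsAdapted i π h b₁ b₂ b) (hc : IsAdapted i π h c₁ c₂ c) :
    b.det c = b₁.det c₁ * b₂.det c₂ := by
  subst h
  simp only [IsAdapted, Fin.cast_eq_self] at hb hc
  have hinr : ∀ (x : E) (m : Fin d₂), b.repr x (Fin.natAdd d₁ m) = b₂.repr (π x) m := by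
    intro x m
    have : b.coord (Fin.natAdd d₁ m) = b₂.coord m ∘ₗ π := by
      refine b.ext fun k => ?_
      induction k using Fin.addCases with
      | left k =>
        have hne : ¬ Fin.castAdd d₂ k = Fin.natAdd d₁ m := fun e => by
          have := congrArg Fin.val e
          simp only [Fin.val_castAdd, Fin.val_natAdd] at this
          omega
        rw [Module.Basis.coord_apply, Module.Basis.repr_self, Finsupp.single_apply, if_neg hne,
          LinearMap.comp_apply, hb.1, hex.apply_apply_eq_zero, map_zero]
      | right k => simp [hb.2, Finsupp.single_apply, Fin.ext_iff]
    exact LinearMap.congr_fun this x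
  have hinl : ∀ (u : E₁) (m : Fin d₁), b.repr (i u) (Fin.castAdd d₂ m) = b₁.repr u m := by
    intro u m
    have : b.coord (Fin.castAdd d₂ m) ∘ₗ i = b₁.coord m := by
      refine b₁.ext fun k => ?_
      simp [← hb.1, Finsupp.single_apply, Fin.ext_iff]
    exact LinearMap.congr_fun this u
  -- The change of basis is block upper triangular: the lower left block is zero because `π ∘ i =
  -- 0`, and the upper right block depends on the lifts but does not affect the determinant.
  rw [Module.Basis.det_apply, Module.Basis.det_apply, Module.Basis.det_apply,
    ← Matrix.det_submatrix_equiv_self finSumFinEquiv, ← Matrix.det_fromBlocks_zero₂₁ _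
      (Matrix.of fun k m => b.repr (c (Fin.natAdd d₁ m)) (Fin.castAdd d₂ k))]
  congr 1
  ext k m
  rcases k with k | k <;> rcases m with m | m
  · simp [Module.Basis.toMatrix_apply, hc.1, hinl]
  · simp [Module.Basis.toMatrix_apply]
  · simp [Module.Basis.toMatrix_apply, hc.1, hinr, hex.apply_apply_eq_zero]
  · simp [Module.Basis.toMatrix_apply, hc.2, hinr]

/-- A product orientation may be tested on one adapted basis. -/
theorem isProductOrientation_of_adapted (hi : Function.Injective i) (hex : Function.Exact i π)
    (hπ : Function.Surjective π) {h : d₁ + d₂ = d} {b₁ : Module.Basis (Fin d₁) ℝ E₁}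
    {b₂ : Module.Basis (Fin d₂) ℝ E₂} {b : Module.Basis (Fin d) ℝ E}
    (hb : IsAdapted i π h b₁ b₂ b) {o₁ : Orientation ℝ E₁ (Fin d₁)}
    {o₂ : Orientation ℝ E₂ (Fin d₂)} {o : Orientation ℝ E (Fin d)}
    (ho : frameSign o b = frameSign o₁ b₁ * frameSign o₂ b₂) :
    IsProductOrientation i π o₁ o₂ o := by
  refine ⟨hi, hex, hπ, h, fun c₁ c₂ c hc hc' => ?_⟩
  -- Passing to another adapted basis multiplies both sides by the same two signs.
  rw [frameSign_change o b c, hb.det_eq hex ⟨hc, hc'⟩, unitSign_mul (basis_det_ne_zero _ _)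
    (basis_det_ne_zero _ _), ho, mul_mul_mul_comm, ← frameSign_change, ← frameSign_change]

theorem IsProductOrientation.frameSign_eq {o₁ : Orientation ℝ E₁ (Fin d₁)}
    {o₂ : Orientation ℝ E₂ (Fin d₂)} {o : Orientation ℝ E (Fin d)}
    (ho : IsProductOrientation i π o₁ o₂ o) {h : d₁ + d₂ = d} {b₁ : Module.Basis (Fin d₁) ℝ E₁}
    {b₂ : Module.Basis (Fin d₂) ℝ E₂} {b : Module.Basis (Fin d) ℝ E}
    (hb : IsAdapted i π h b₁ b₂ b) : frameSign o b = frameSign o₁ b₁ * frameSign o₂ b₂ :=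
  let ⟨_, hs⟩ := ho.sign
  hs b₁ b₂ b hb.1 hb.2

/-- Comparison of a triple of orientations with a product orientation. -/
theorem IsProductOrientation.iff_signs {o₁ p₁ : Orientation ℝ E₁ (Fin d₁)}
    {o₂ p₂ : Orientation ℝ E₂ (Fin d₂)} {o p : Orientation ℝ E (Fin d)}
    (ho : IsProductOrientation i π o₁ o₂ o) (c₁ : Module.Basis (Fin d₁) ℝ E₁)
    (c₂ : Module.Basis (Fin d₂) ℝ E₂) (c : Module.Basis (Fin d) ℝ E) :
    IsProductOrientation i π p₁ p₂ p ↔ frameSign o c * frameSign p c =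
      (frameSign o₁ c₁ * frameSign p₁ c₁) * (frameSign o₂ c₂ * frameSign p₂ c₂) := by
  obtain ⟨h, -⟩ := ho.sign
  obtain ⟨b, hb⟩ := exists_adapted ho.injective ho.exact ho.surjective h c₁ c₂
  -- The product of the signs of one basis for two orientations does not depend on the basis, so `c`
  -- may be replaced by the adapted basis `b`.
  rw [frameSign_mul_frameSign_eq o p c b, ho.frameSign_eq hb, mul_mul_mul_comm (frameSign o₁ c₁),
    mul_right_inj]
  exact ⟨fun hp => hp.frameSign_eq hb,
    isProductOrientation_of_adapted ho.injective ho.exact ho.surjective hb⟩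

theorem exists_isProductOrientation (hi : Function.Injective i) (hex : Function.Exact i π)
    (hπ : Function.Surjective π) (h : d₁ + d₂ = d) (b₁ : Module.Basis (Fin d₁) ℝ E₁)
    (b₂ : Module.Basis (Fin d₂) ℝ E₂) (o₁ : Orientation ℝ E₁ (Fin d₁))
    (o₂ : Orientation ℝ E₂ (Fin d₂)) :
    ∃ o : Orientation ℝ E (Fin d), IsProductOrientation i π o₁ o₂ o := by
  obtain ⟨b, hb⟩ := exists_adapted hi hex hπ h b₁ b₂
  obtain ⟨o, ho⟩ := exists_frameSign_eq b (frameSign o₁ b₁ * frameSign o₂ b₂)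
  exact ⟨o, isProductOrientation_of_adapted hi hex hπ hb ho⟩

theorem exists_isProductOrientation_left (hi : Function.Injective i) (hex : Function.Exact i π)
    (hπ : Function.Surjective π) (h : d₁ + d₂ = d) (b₁ : Module.Basis (Fin d₁) ℝ E₁)
    (b₂ : Module.Basis (Fin d₂) ℝ E₂) (o₂ : Orientation ℝ E₂ (Fin d₂))
    (o : Orientation ℝ E (Fin d)) :
    ∃ o₁ : Orientation ℝ E₁ (Fin d₁), IsProductOrientation i π o₁ o₂ o := by
  obtain ⟨b, hb⟩ := exists_adapted hi hex hπ h b₁ b₂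
  obtain ⟨o₁, ho⟩ := exists_frameSign_eq b₁ (frameSign o b * frameSign o₂ b₂)
  refine ⟨o₁, isProductOrientation_of_adapted hi hex hπ hb ?_⟩
  rw [ho, mul_assoc, Int.units_mul_self, mul_one]

theorem exists_isProductOrientation_right (hi : Function.Injective i) (hex : Function.Exact i π)
    (hπ : Function.Surjective π) (h : d₁ + d₂ = d) (b₁ : Module.Basis (Fin d₁) ℝ E₁)
    (b₂ : Module.Basis (Fin d₂) ℝ E₂) (o₁ : Orientation ℝ E₁ (Fin d₁))
    (o : Orientation ℝ E (Fin d)) :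
    ∃ o₂ : Orientation ℝ E₂ (Fin d₂), IsProductOrientation i π o₁ o₂ o := by
  obtain ⟨b, hb⟩ := exists_adapted hi hex hπ h b₁ b₂
  obtain ⟨o₂, ho⟩ := exists_frameSign_eq b₂ (frameSign o₁ b₁ * frameSign o b)
  refine ⟨o₂, isProductOrientation_of_adapted hi hex hπ hb ?_⟩
  rw [ho, ← mul_assoc, Int.units_mul_self, one_mul]

end Product

/-! ### Orientations of the tangent bundle along a map, in charts -/

/-- The standard basis of `ℝᵏ`. -/
def stdBasis (k : ℕ) : Module.Basis (Fin k) ℝ (Euc k) := (EuclideanSpace.basisFun (Fin k) ℝ).toBasis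

theorem continuous_basis_det {V : Type*} [NormedAddCommGroup V] [NormedSpace ℝ V]
    [FiniteDimensional ℝ V] {d : ℕ} (g : Module.Basis (Fin d) ℝ V) :
    Continuous fun v : Fin d → V => g.det v := by
  simp only [Module.Basis.det_apply]
  refine Continuous.matrix_det (continuous_matrix fun i j => ?_)
  simp only [Module.Basis.toMatrix_apply]
  exact (g.coord i).continuous_of_finiteDimensional.comp (continuous_apply j)

section Charts

variable {n : ℕ} {M : Type*} [TopologicalSpace M] [ChartedSpace (Euc n) M]
  [IsManifold (𝓡 n) ∞ M]

/-- The change of coordinates in `T_p M` from the preferred chart at `p` to the one at `p₀`. -/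
def toChart (p₀ p : M) : Euc n →L[ℝ] Euc n := tangentCoordChange (𝓡 n) p p₀ p

/-- The change of coordinates in `T_p M` from the preferred chart at `p₀` to the one at `p`. -/
def ofChart (p₀ p : M) : Euc n →L[ℝ] Euc n := tangentCoordChange (𝓡 n) p₀ p p

theorem toChart_ofChart {p₀ p : M} (h : p ∈ (chartAt (Euc n) p₀).source) (v : Euc n) :
    toChart p₀ p (ofChart p₀ p v) = v := by
  have hp : p ∈ (extChartAt (𝓡 n) p₀).source := by simpa using h
  unfold toChart ofChart
  rw [tangentCoordChange_comp ⟨⟨hp, by simp⟩, hp⟩, tangentCoordChange_self hp]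

theorem ofChart_toChart {p₀ p : M} (h : p ∈ (chartAt (Euc n) p₀).source) (v : Euc n) :
    ofChart p₀ p (toChart p₀ p v) = v := by
  have hp : p ∈ (extChartAt (𝓡 n) p₀).source := by simpa using h
  unfold toChart ofChart
  rw [tangentCoordChange_comp ⟨⟨by simp, hp⟩, by simp⟩, tangentCoordChange_self (by simp)]

theorem toChart_self (p : M) (v : Euc n) : toChart p p v = v :=
  tangentCoordChange_self (by simp)

/-- The identification of `T_p M` with `ℝⁿ` through the chart at `p₀`. -/
def chartEquiv {p₀ p : M} (h : p ∈ (chartAt (Euc n) p₀).source) : Euc n ≃ₗ[ℝ] Euc n :=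
  LinearEquiv.ofLinearMap (toChart p₀ p).toLinearMap (ofChart p₀ p).toLinearMap
    (LinearMap.ext (toChart_ofChart h)) (LinearMap.ext (ofChart_toChart h))

theorem chartEquiv_symm_apply {p₀ p : M} (h : p ∈ (chartAt (Euc n) p₀).source) (v : Euc n) :
    (chartEquiv h).symm v = ofChart p₀ p v := rfl

theorem det_toChart_ne_zero {p₀ p : M} (h : p ∈ (chartAt (Euc n) p₀).source) :
    LinearMap.det (toChart (n := n) p₀ p).toLinearMap ≠ 0 :=
  (LinearEquiv.isUnit_det' (chartEquiv h)).ne_zero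

variable (n) in
/-- The sign of the change of coordinates in `T_p M` from the chart at `p` to the one at `p₀`. -/
def chartSign (p₀ p : M) : ℤˣ := unitSign (LinearMap.det (toChart (n := n) p₀ p).toLinearMap)

/-- Multiplicativity of determinants. The left-hand side mentions no frame; on the right, `b` is
read in the chart at `p₀`, where its determinant varies continuously with a continuous frame. -/
theorem frameSign_mul_chartSign {p₀ p : M} (h : p ∈ (chartAt (Euc n) p₀).source)
    (o : Orientation ℝ (Euc n) (Fin n)) (b : Module.Basis (Fin n) ℝ (Euc n)) :
    frameSign o (stdBasis n) * chartSign n p₀ p =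
      frameSign o b * unitSign ((stdBasis n).det fun j => toChart p₀ p (b j)) := by
  have : (stdBasis n).det (fun j => toChart p₀ p (b j)) =
      LinearMap.det (toChart (n := n) p₀ p).toLinearMap * (stdBasis n).det b :=
    (stdBasis n).det_comp (toChart p₀ p).toLinearMap b
  rw [this, unitSign_mul (det_toChart_ne_zero h) (basis_det_ne_zero _ _),
    frameSign_change o (stdBasis n) b, chartSign]
  rw [mul_comm (unitSign (LinearMap.det _)), ← mul_assoc, mul_assoc (frameSign o (stdBasis n)),
    Int.units_mul_self, mul_one]

variable {B : Type*} [TopologicalSpace B]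

/-- Continuity of a section of `TM` along `f`, in a chart. -/
theorem continuousAt_section_iff {f : B → M} {t : B → Euc n} {b₀ : B} {p₀ : M}
    (h : f b₀ ∈ (chartAt (Euc n) p₀).source) :
    ContinuousAt (fun b => (⟨f b, t b⟩ : TangentBundle (𝓡 n) M)) b₀ ↔
      ContinuousAt f b₀ ∧ ContinuousAt (fun b => toChart p₀ (f b) (t b)) b₀ :=
  (trivializationAt (Euc n) (TangentSpace (𝓡 n)) p₀).tendsto_nhds_iff h

theorem continuousAt_ofChart {f : B → M} {b₀ : B} {p₀ : M} (hf : ContinuousAt f b₀)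
    (h : f b₀ ∈ (chartAt (Euc n) p₀).source) (v : Euc n) :
    ContinuousAt (fun b => (⟨f b, ofChart p₀ (f b) v⟩ : TangentBundle (𝓡 n) M)) b₀ := by
  refine (continuousAt_section_iff h).2 ⟨hf, (continuousAt_const (y := v)).congr ?_⟩
  filter_upwards [hf.eventually ((chartAt (Euc n) p₀).open_source.mem_nhds h)] with b hb
  exact (toChart_ofChart hb v).symm

/-- The signs of the vectors of the chart at `f b₀` with respect to the orientations `o` are
constant near `b₀`. -/
def IsSignContinuousAt (f : B → M) (o : B → Orientation ℝ (Euc n) (Fin n)) (b₀ : B) : Prop :=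
  ContinuousAt (fun b => frameSign (o b) (stdBasis n) * chartSign n (f b₀) (f b)) b₀

/-- The sign condition may be tested on any frame that is continuous at the point. -/
theorem isSignContinuousAt_iff_frame {f : B → M} {o : B → Orientation ℝ (Euc n) (Fin n)} {b₀ : B}
    (hf : ContinuousAt f b₀) (t : Fin n → B → Euc n)
    (ht : ∀ j, ContinuousAt (fun b => (⟨f b, t j b⟩ : TangentBundle (𝓡 n) M)) b₀)
    (hb : ∀ᶠ b in 𝓝 b₀, ∃ e : Module.Basis (Fin n) ℝ (Euc n), ∀ j, e j = t j b) :
    IsSignContinuousAt f o b₀ ↔ ∃ ε, ∀ᶠ b in 𝓝 b₀, ∀ e : Module.Basis (Fin n) ℝ (Euc n),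
      (∀ j, e j = t j b) → frameSign (o b) e = ε := by
  -- The frame read in one fixed chart: `D` is continuous and non-zero at `b₀`, so its sign is
  -- locally constant and drops out of the comparison.
  set D : B → ℝ := fun b => (stdBasis n).det fun j => toChart (f b₀) (f b) (t j b) with hD
  have hsrc := mem_chart_source (Euc n) (f b₀)
  have hDc : ContinuousAt D b₀ := (continuous_basis_det (stdBasis n)).continuousAt.comp
    (continuousAt_pi.2 fun j => ((continuousAt_section_iff hsrc).1 (ht j)).2)
  have hD0 : D b₀ ≠ 0 := by
    obtain ⟨e, he⟩ := hb.self_of_nhds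
    have := basis_det_ne_zero (stdBasis n) e
    simpa [hD, toChart_self, ← he] using this
  have hu : ContinuousAt (fun b => unitSign (D b)) b₀ :=
    ContinuousAt.comp (f := D) (continuousAt_unitSign hD0) hDc
  have hev : ∀ᶠ b in 𝓝 b₀, ∃ e : Module.Basis (Fin n) ℝ (Euc n), (∀ j, e j = t j b) ∧
      frameSign (o b) (stdBasis n) * chartSign n (f b₀) (f b) =
        frameSign (o b) e * unitSign (D b) := by
    filter_upwards [hb, hf.eventually ((chartAt (Euc n) (f b₀)).open_source.mem_nhds hsrc)]
      with b ⟨e, he⟩ hb'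
    refine ⟨e, he, ?_⟩
    rw [frameSign_mul_chartSign hb' (o b) e]
    simp only [hD, he]
  obtain ⟨δ, hδ⟩ := continuousAt_units_iff.1 hu
  rw [IsSignContinuousAt, continuousAt_units_iff]
  constructor
  · rintro ⟨ε, h⟩
    refine ⟨ε * δ, ?_⟩
    filter_upwards [h, hδ, hev] with b h1 h2 ⟨e, he, h3⟩ e' he'
    obtain rfl : e' = e := Module.Basis.eq_of_apply_eq fun j => (he' j).trans (he j).symm
    rw [← h1, h3, h2, mul_assoc, Int.units_mul_self, mul_one]
  · rintro ⟨ε, h⟩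
    refine ⟨ε * δ, ?_⟩
    filter_upwards [h, hδ, hev] with b h1 h2 ⟨e, he, h3⟩
    rw [h3, h1 e he, h2]

theorem isSignContinuousAt_of_orientation {f : B → M} (hf : Continuous f)
    (o : TangentOrientationAlong (n := n) f) (b₀ : B) : IsSignContinuousAt f o.orient b₀ := by
  obtain ⟨s, ε, h⟩ := o.continuous b₀
  refine (isSignContinuousAt_iff_frame hf.continuousAt s (fun j => (h.self_of_nhds).1 j)
    (h.mono fun b hb => ?_)).2 ⟨ε, h.mono fun b hb e he => ?_⟩
  · obtain ⟨e, he, -⟩ := hb.2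
    exact ⟨e, he⟩
  · obtain ⟨e', he', h'⟩ := hb.2
    obtain rfl : e = e' := Module.Basis.eq_of_apply_eq fun j => (he j).trans (he' j).symm
    exact h'

/-- The frame of the chart at `f b₀` has a locally constant sign. -/
theorem IsSignContinuousAt.exists_frameSign_ofChart {f : B → M} (hf : Continuous f)
    {o : B → Orientation ℝ (Euc n) (Fin n)} {b₀ : B} (ho : IsSignContinuousAt f o b₀) :
    ∃ ε, ∀ᶠ b in 𝓝 b₀, f b ∈ (chartAt (Euc n) (f b₀)).source ∧
      ∃ e : Module.Basis (Fin n) ℝ (Euc n),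
        (∀ j, e j = ofChart (f b₀) (f b) (stdBasis n j)) ∧ frameSign (o b) e = ε := by
  have hsrc := mem_chart_source (Euc n) (f b₀)
  have hev := hf.continuousAt.eventually
    ((chartAt (Euc n) (f b₀)).open_source.mem_nhds hsrc)
  have hbas : ∀ᶠ b in 𝓝 b₀, ∃ e : Module.Basis (Fin n) ℝ (Euc n),
      ∀ j, e j = ofChart (f b₀) (f b) (stdBasis n j) :=
    hev.mono fun b hb => ⟨(stdBasis n).map (chartEquiv hb).symm, fun j => rfl⟩
  obtain ⟨ε, hε⟩ := (isSignContinuousAt_iff_frame hf.continuousAt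
    (fun j b => ofChart (f b₀) (f b) (stdBasis n j))
    (fun j => continuousAt_ofChart hf.continuousAt hsrc _) hbas).1 ho
  refine ⟨ε, ?_⟩
  filter_upwards [hev, hε, hbas] with b h1 h2 ⟨e, he⟩ using ⟨h1, e, he, h2 e he⟩

/-- An orientation of `TM` along `f` from orientations of the fibres with locally constant
signs. -/
def orientationOfSigns {f : B → M} (hf : Continuous f) (o : B → Orientation ℝ (Euc n) (Fin n))
    (ho : ∀ b₀, IsSignContinuousAt f o b₀) : TangentOrientationAlong (n := n) f where
  orient := o
  continuous b₀ := by
    obtain ⟨ε, hε⟩ := (ho b₀).exists_frameSign_ofChart hf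
    exact ⟨fun j b => ofChart (f b₀) (f b) (stdBasis n j), ε, hε.mono fun b hb =>
      ⟨fun j => continuousAt_ofChart hf.continuousAt hb.1 _, hb.2⟩⟩

theorem det_coordChange_ne_zero {i j : atlas (Euc n) M} {x : M} (hx : x ∈ i.1.source ∩ j.1.source) :
    LinearMap.det ((tangentBundleCore (𝓡 n) M).coordChange i j x).toLinearMap ≠ 0 := by
  have : ((tangentBundleCore (𝓡 n) M).coordChange j i x).toLinearMap ∘ₗ
      ((tangentBundleCore (𝓡 n) M).coordChange i j x).toLinearMap = LinearMap.id :=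
    LinearMap.ext fun v => ((tangentBundleCore (𝓡 n) M).coordChange_comp i j i x ⟨hx, hx.1⟩ v).trans
      ((tangentBundleCore (𝓡 n) M).coordChange_self i x hx.1 v)
  intro h
  have h1 := congrArg LinearMap.det this
  rw [LinearMap.det_comp, h, mul_zero, LinearMap.det_id] at h1
  exact zero_ne_one h1

/-- The orientation double cover of `M`. -/
def orientationCover (n : ℕ) (M : Type*) [TopologicalSpace M] [ChartedSpace (Euc n) M]
    [IsManifold (𝓡 n) ∞ M] : FiberBundleCore (atlas (Euc n) M) M ℤˣ where
  baseSet i := i.1.source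
  isOpen_baseSet i := i.1.open_source
  indexAt := achart (Euc n)
  mem_baseSet_at := mem_chart_source (Euc n)
  -- A point of the fibre over `x`, seen in a chart, is a sign for the frame of that chart; the
  -- Jacobian of the coordinate change transforms it.
  coordChange i j x v :=
    unitSign (LinearMap.det ((tangentBundleCore (𝓡 n) M).coordChange i j x).toLinearMap) * v
  coordChange_self i x hx v := by
    have : ((tangentBundleCore (𝓡 n) M).coordChange i i x).toLinearMap = LinearMap.id :=
      LinearMap.ext fun v => (tangentBundleCore (𝓡 n) M).coordChange_self i x hx v
    rw [this, LinearMap.det_id]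
    simp [unitSign]
  continuousOn_coordChange i j := by
    rintro ⟨x, v⟩ ⟨hx, -⟩
    have hd : Continuous fun A : Euc n →L[ℝ] Euc n => LinearMap.det A.toLinearMap :=
      ContinuousLinearMap.continuous_det
    have hc := (tangentBundleCore (𝓡 n) M).continuousOn_coordChange i j x hx
    have h1 : ContinuousWithinAt (fun p : M × ℤˣ => LinearMap.det
        ((tangentBundleCore (𝓡 n) M).coordChange i j p.1).toLinearMap)
        ((i.1.source ∩ j.1.source) ×ˢ Set.univ) (x, v) :=
      (hd.continuousAt.comp_continuousWithinAt hc).comp (f := Prod.fst) (x := (x, v))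
        continuousWithinAt_fst fun p hp => hp.1
    exact (ContinuousAt.comp_continuousWithinAt (x := ((x, v) : M × ℤˣ))
      (continuousAt_unitSign (det_coordChange_ne_zero hx)) h1).mul continuousWithinAt_snd
  coordChange_comp i j k x hx v := by
    have : ((tangentBundleCore (𝓡 n) M).coordChange i k x).toLinearMap =
        ((tangentBundleCore (𝓡 n) M).coordChange j k x).toLinearMap ∘ₗ
          ((tangentBundleCore (𝓡 n) M).coordChange i j x).toLinearMap :=
      LinearMap.ext fun v => ((tangentBundleCore (𝓡 n) M).coordChange_comp i j k x hx v).symm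
    rw [this, LinearMap.det_comp, unitSign_mul (det_coordChange_ne_zero ⟨hx.1.2, hx.2⟩)
      (det_coordChange_ne_zero hx.1), mul_assoc]

/-- Over a simply connected space every continuous map to `M` lifts to the orientation cover. -/
theorem exists_orientation_along [SimplyConnectedSpace B] [LocallyPathConnectedSpace B] {f : B → M}
    (hf : Continuous f) : Nonempty (TangentOrientationAlong (n := n) f) := by
  obtain ⟨b₀⟩ : Nonempty B := inferInstance
  let Z := orientationCover n M
  have hcov : IsCoveringMap (Bundle.TotalSpace.proj : Z.TotalSpace → M) :=
    FiberBundle.isCoveringMap (F := ℤˣ) (E := Z.Fiber)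
  -- The starting value `1` over `f b₀` is an arbitrary choice of sheet.
  obtain ⟨F, ⟨-, hF⟩, -⟩ := hcov.existsUnique_continuousMap_lifts ⟨f, hf⟩ b₀ ⟨f b₀, (1 : ℤˣ)⟩ rfl
  have hFf : ∀ b, (F b).proj = f b := fun b => congrFun hF b
  choose o ho using fun b => exists_frameSign_eq (stdBasis n) (show ℤˣ from (F b).2)
  refine ⟨orientationOfSigns hf o fun b₁ => ?_⟩
  -- Continuity of the lift in the local trivialization at `f b₁` is exactly the local constancy of
  -- the chart-corrected sign.
  have := (FiberBundle.continuousAt_totalSpace (F := ℤˣ) (E := Z.Fiber) F).1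
    (F.continuous.continuousAt (x := b₁))
  refine this.2.congr (Filter.Eventually.of_forall fun b => ?_)
  dsimp only
  rw [ho b, ← hFf b, ← hFf b₁, mul_comm]
  rfl

end Charts

/-! ### Frames assembled from two families of vectors -/

section Frames

/-- Two families of vectors, one after the other. -/
def joinFrames {E : Type*} {d₁ d₂ d : ℕ} (h : d₁ + d₂ = d) (u : Fin d₁ → E) (w : Fin d₂ → E) :
    Fin d → E := fun m => Fin.addCases u w (Fin.cast h.symm m)

theorem eq_joinFrames_iff {E : Type*} {d₁ d₂ d : ℕ} (h : d₁ + d₂ = d) (u : Fin d₁ → E)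
    (w : Fin d₂ → E) (b : Fin d → E) :
    (∀ m, b m = joinFrames h u w m) ↔ (∀ j, b (Fin.cast h (Fin.castAdd d₂ j)) = u j) ∧
      ∀ j, b (Fin.cast h (Fin.natAdd d₁ j)) = w j := by
  subst h
  constructor
  · intro hb
    constructor <;> intro j <;> rw [hb] <;> simp [joinFrames]
  · rintro ⟨h1, h2⟩ m
    induction m using Fin.addCases with
    | left j => simpa [joinFrames] using h1 j
    | right j => simpa [joinFrames] using h2 j

theorem joinFrames_forall {E : Type*} {d₁ d₂ d : ℕ} (h : d₁ + d₂ = d) {u : Fin d₁ → E}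
    {w : Fin d₂ → E} {P : E → Prop} (hu : ∀ j, P (u j)) (hw : ∀ j, P (w j)) (m : Fin d) :
    P (joinFrames h u w m) := by
  subst h
  induction m using Fin.addCases with
  | left j => simpa [joinFrames] using hu j
  | right j => simpa [joinFrames] using hw j

theorem joinFrames_apply {B E : Type*} {d₁ d₂ d : ℕ} (h : d₁ + d₂ = d) (u : Fin d₁ → B → E)
    (w : Fin d₂ → B → E) (m : Fin d) (b : B) :
    joinFrames h u w m b = joinFrames h (fun j => u j b) (fun j => w j b) m := by
  subst h
  induction m using Fin.addCases with
  | left j => simp [joinFrames]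
  | right j => simp [joinFrames]

/-- The last vectors of a basis of `E` whose first vectors form a basis of `E₁` project to a basis
of `E₂`. -/
theorem exists_adapted_of_basis {E₁ E E₂ : Type*} [AddCommGroup E₁] [Module ℝ E₁]
    [AddCommGroup E] [Module ℝ E] [AddCommGroup E₂] [Module ℝ E₂] {d₁ d₂ d : ℕ}
    {i : E₁ →ₗ[ℝ] E} {π : E →ₗ[ℝ] E₂} (hex : Function.Exact i π) (hπ : Function.Surjective π)
    (h : d₁ + d₂ = d) (b₁ : Module.Basis (Fin d₁) ℝ E₁) (hd : Module.finrank ℝ E₂ = d₂)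
    (b : Module.Basis (Fin d) ℝ E) (hb : ∀ j, b (Fin.cast h (Fin.castAdd d₂ j)) = i (b₁ j)) :
    ∃ b₂ : Module.Basis (Fin d₂) ℝ E₂, IsAdapted i π h b₁ b₂ b := by
  -- The images of all basis vectors span `E₂`, and `π` kills the first `d₁`; the remaining `d₂`
  -- span, hence form a basis by dimension.
  have hspan : ⊤ ≤ Submodule.span ℝ
      (Set.range fun j : Fin d₂ => π (b (Fin.cast h (Fin.natAdd d₁ j)))) := by
    intro x _
    obtain ⟨y, rfl⟩ := hπ x
    rw [← b.sum_repr y, map_sum]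
    refine Submodule.sum_mem _ fun m _ => ?_
    rw [map_smul]
    refine Submodule.smul_mem _ _ ?_
    subst h
    induction m using Fin.addCases with
    | left j =>
      have := hb j
      simp only [Fin.cast_eq_self] at this
      rw [this, hex.apply_apply_eq_zero]
      exact Submodule.zero_mem _
    | right j => exact Submodule.subset_span ⟨j, rfl⟩
  exact ⟨basisOfTopLeSpanOfCardEqFinrank _ hspan (by simp [hd]), hb, fun j => by simp⟩

end Frames

/-! ### Nearby frames, and comparison of orientations over a connected base -/

section Charts

variable {n : ℕ} {M : Type*} [TopologicalSpace M] [ChartedSpace (Euc n) M]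
  [IsManifold (𝓡 n) ∞ M] {B : Type*} [TopologicalSpace B]

/-- Sections of `TM` along `f` that are continuous at `b₀` and form a basis there form a basis at
all nearby points. -/
theorem eventually_exists_basis {f : B → M} {b₀ : B} (hf : ContinuousAt f b₀)
    (t : Fin n → B → Euc n)
    (ht : ∀ j, ContinuousAt (fun b => (⟨f b, t j b⟩ : TangentBundle (𝓡 n) M)) b₀)
    (e₀ : Module.Basis (Fin n) ℝ (Euc n)) (he₀ : ∀ j, e₀ j = t j b₀) :
    ∀ᶠ b in 𝓝 b₀, ∃ e : Module.Basis (Fin n) ℝ (Euc n), ∀ j, e j = t j b := by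
  have hsrc := mem_chart_source (Euc n) (f b₀)
  have hDc : ContinuousAt
      (fun b => (stdBasis n).det fun j => toChart (f b₀) (f b) (t j b)) b₀ :=
    (continuous_basis_det (stdBasis n)).continuousAt.comp
      (continuousAt_pi.2 fun j => ((continuousAt_section_iff hsrc).1 (ht j)).2)
  have hD0 : (stdBasis n).det (fun j => toChart (f b₀) (f b₀) (t j b₀)) ≠ 0 := by
    have := basis_det_ne_zero (stdBasis n) e₀
    simpa [toChart_self, ← he₀] using this
  filter_upwards [hDc.eventually_ne hD0,
    hf.eventually ((chartAt (Euc n) (f b₀)).open_source.mem_nhds hsrc)] with b hb hb'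
  -- Where the determinant in the fixed chart is non-zero, the vectors form a basis in that chart,
  -- which is then carried back to `T_p M`.
  obtain ⟨hli, hsp⟩ := (Module.Basis.is_basis_iff_det (stdBasis n)).2 (isUnit_iff_ne_zero.2 hb)
  refine ⟨(Module.Basis.mk hli hsp.ge).map (chartEquiv hb').symm, fun j => ?_⟩
  rw [Module.Basis.map_apply, Module.Basis.mk_apply, chartEquiv_symm_apply, ofChart_toChart hb']

/-- Two orientations of `TM` along `f`, over a connected base, that agree at one point agree
everywhere. -/
theorem frameSign_mul_const_of_isSignContinuousAt [PreconnectedSpace B] {f : B → M}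
    {o o' : B → Orientation ℝ (Euc n) (Fin n)}
    (ho : ∀ b, IsSignContinuousAt f o b) (ho' : ∀ b, IsSignContinuousAt f o' b) (b b' : B) :
    frameSign (o b) (stdBasis n) * frameSign (o' b) (stdBasis n) =
      frameSign (o b') (stdBasis n) * frameSign (o' b') (stdBasis n) := by
  have hc : Continuous fun b => frameSign (o b) (stdBasis n) * frameSign (o' b) (stdBasis n) := by
    -- Both orientations carry the same chart sign, which cancels in the product; what remains is a
    -- locally constant function on a connected space.
    refine continuous_iff_continuousAt.2 fun b₀ => ((ho b₀).mul (ho' b₀)).congr ?_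
    refine Filter.Eventually.of_forall fun b => ?_
    rw [Pi.mul_apply, mul_mul_mul_comm, Int.units_mul_self, mul_one]
  exact PreconnectedSpace.constant inferInstance hc

end Charts

/-! ### Orientations of the normal bundle of a cell -/

namespace ImmersedCell

section

variable {n : ℕ} {M : Type*} [TopologicalSpace M] [ChartedSpace (Euc n) M]
  {k d : ℕ} {W : Set M} (i : ImmersedCell n k W)

theorem diff_injective (a : Euc k) : Function.Injective (i.diff a) := i.immersion a

theorem exact_diff_mkQ (a : Euc k) : Function.Exact (i.diff a) (i.tangent a).mkQ := by
  rw [LinearMap.exact_iff, Submodule.ker_mkQ]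
  rfl

theorem continuous_toFun : Continuous i.toFun := i.smooth.continuous

theorem finrank_normal (h : k + d = n) (a : Euc k) :
    Module.finrank ℝ (Euc n ⧸ i.tangent a) = d := by
  have h1 := (i.tangent a).finrank_quotient_add_finrank
  have h2 : Module.finrank ℝ (i.tangent a) = k := by
    have := LinearMap.finrank_range_of_inj (i.diff_injective a)
    rw [finrank_euclideanSpace_fin] at this
    exact this
  rw [h2, finrank_euclideanSpace_fin] at h1
  omega

/-- The orientation of the normal space `p` corresponds to the orientation `o` of the tangent space
of `M`, through the standard orientation of the cell. -/
def IsNormalProduct (a : Euc k) (p : Orientation ℝ (Euc n ⧸ i.tangent a) (Fin d))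
    (o : Orientation ℝ (Euc n) (Fin n)) : Prop :=
  IsProductOrientation (E := Euc n) (i.diff a) (i.tangent a).mkQ (stdBasis k).orientation p o

/-- A basis of the normal space. -/
def normalBasis (h : k + d = n) (a : Euc k) : Module.Basis (Fin d) ℝ (Euc n ⧸ i.tangent a) :=
  Module.finBasisOfFinrankEq ℝ _ (i.finrank_normal h a)

theorem exists_isNormalProduct_right (h : k + d = n) (a : Euc k)
    (p : Orientation ℝ (Euc n ⧸ i.tangent a) (Fin d)) : ∃ o, i.IsNormalProduct a p o :=
  exists_isProductOrientation (i.diff_injective a) (i.exact_diff_mkQ a)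
    (Submodule.mkQ_surjective _) h (stdBasis k) (i.normalBasis h a) _ p

theorem exists_isNormalProduct_left (h : k + d = n) (a : Euc k)
    (o : Orientation ℝ (Euc n) (Fin n)) :
    ∃ p : Orientation ℝ (Euc n ⧸ i.tangent a) (Fin d), i.IsNormalProduct a p o :=
  exists_isProductOrientation_right (i.diff_injective a) (i.exact_diff_mkQ a)
    (Submodule.mkQ_surjective _) h (stdBasis k) (i.normalBasis h a) _ o

end

variable {n : ℕ} {M : Type*} [TopologicalSpace M] [ChartedSpace (Euc n) M]
  [IsManifold (𝓡 n) ∞ M] {k d : ℕ} {W : Set M} (i : ImmersedCell n k W)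

/-- The tangent map of the immersion is continuous, and is applied here to a constant section of the
tangent bundle of `ℝᵏ`. -/
theorem continuous_diff (v : Euc k) :
    Continuous fun a => (⟨i.toFun a, i.diff a v⟩ : TangentBundle (𝓡 n) M) := by
  have h1 := i.smooth.continuous_tangentMap (by simp)
  have h2 : Continuous fun a : Euc k => (⟨a, v⟩ : TangentBundle (𝓡 k) (Euc k)) :=
    (tangentBundleModelSpaceHomeomorph (𝓡 k)).symm.continuous.comp
      (Continuous.prodMk_left v : Continuous fun a : Euc k => (a, v))
  exact h1.comp h2

/-- The standard frame of the cell followed by lifts of a continuous normal frame is a continuous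
frame of `TM`. Its sign is that of the normal frame, since the tangential part has sign `1`. -/
theorem isSignContinuousAt_of_normalOrientation (h : k + d = n) (ν : i.NormalOrientation d)
    {o : Euc k → Orientation ℝ (Euc n) (Fin n)}
    (ho : ∀ a, i.IsNormalProduct a (ν.orient a) (o a)) (a₀ : Euc k) :
    IsSignContinuousAt i.toFun o a₀ := by
  obtain ⟨s, ε, hs⟩ := ν.continuous a₀
  have hlift : ∀ j, ∃ t : Euc k → Euc n,
      ContinuousAt (fun a => (⟨i.toFun a, t a⟩ : TangentBundle (𝓡 n) M)) a₀ ∧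
        ∀ᶠ a in 𝓝 a₀, (i.tangent a).mkQ (t a) = s j a := hs.self_of_nhds.1
  choose t htc hts using hlift
  have hts' := Filter.eventually_all.2 hts
  have hadapt : ∀ᶠ a in 𝓝 a₀, ∃ (c : Module.Basis (Fin d) ℝ (Euc n ⧸ i.tangent a))
      (e : Module.Basis (Fin n) ℝ (Euc n)),
      frameSign (ν.orient a) c = ε ∧ IsAdapted (i.diff a) (i.tangent a).mkQ h (stdBasis k) c e ∧
      ∀ m, e m = joinFrames h (fun j a => i.diff a (stdBasis k j)) t m a := by
    filter_upwards [hs, hts'] with a ha ha'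
    obtain ⟨c, hc, hcε⟩ := ha.2
    obtain ⟨e, he, het⟩ := exists_adapted_of_lift (i.diff_injective a) (i.exact_diff_mkQ a) h
      (stdBasis k) c (fun j => t j a) fun j => (ha' j).trans (hc j).symm
    refine ⟨c, e, hcε, he, fun m => ?_⟩
    rw [joinFrames_apply]
    exact (eq_joinFrames_iff h _ _ e).2 ⟨he.1, het⟩ m
  refine (isSignContinuousAt_iff_frame i.continuous_toFun.continuousAt
    (joinFrames h (fun j a => i.diff a (stdBasis k j)) t) ?_
    (hadapt.mono fun a ⟨c, e, _, _, he⟩ => ⟨e, he⟩)).2 ⟨ε, ?_⟩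
  · exact joinFrames_forall h (P := fun u : Euc k → Euc n =>
      ContinuousAt (fun a => (⟨i.toFun a, u a⟩ : TangentBundle (𝓡 n) M)) a₀)
      (fun j => (i.continuous_diff _).continuousAt) htc
  · filter_upwards [hadapt] with a ⟨c, e, hc, hce, he⟩ e' he'
    obtain rfl : e' = e := Module.Basis.eq_of_apply_eq fun j => (he' j).trans (he j).symm
    rw [(ho a).frameSign_eq hce, frameSign_orientation, one_mul, hc]

/-- An orientation of the normal bundle from an orientation of `TM` along the cell. -/
def normalOrientationOfSigns (h : k + d = n)
    (p : ∀ a, Orientation ℝ (Euc n ⧸ i.tangent a) (Fin d))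
    (o : Euc k → Orientation ℝ (Euc n) (Fin n)) (hp : ∀ a, i.IsNormalProduct a (p a) (o a))
    (ho : ∀ a, IsSignContinuousAt i.toFun o a) : i.NormalOrientation d where
  orient := p
  continuous a₀ := by
    have hsrc := mem_chart_source (Euc n) (i.toFun a₀)
    have hcont := i.continuous_toFun.continuousAt (x := a₀)
    obtain ⟨e₀, he₀⟩ := exists_adapted (i.diff_injective a₀) (i.exact_diff_mkQ a₀)
      (Submodule.mkQ_surjective _) h (stdBasis k) (i.normalBasis h a₀)
    -- The complementary vectors at `a₀` are kept constant in the chart at `i.toFun a₀`. Near `a₀`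
    -- they still complete the tangential frame, so their classes form a normal frame.
    let t : Fin d → Euc k → Euc n := fun j a =>
      ofChart (i.toFun a₀) (i.toFun a) (e₀ (Fin.cast h (Fin.natAdd k j)))
    have ht : ∀ j a, i.toFun a ∈ (chartAt (Euc n) (i.toFun a₀)).source →
        ContinuousAt (fun a => (⟨i.toFun a, t j a⟩ : TangentBundle (𝓡 n) M)) a :=
      fun j a ha => continuousAt_ofChart i.continuous_toFun.continuousAt ha _
    let T := joinFrames h (fun j a => i.diff a (stdBasis k j)) t
    have hT : ∀ m, ContinuousAt (fun a => (⟨i.toFun a, T m a⟩ : TangentBundle (𝓡 n) M)) a₀ :=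
      joinFrames_forall h (P := fun u : Euc k → Euc n =>
        ContinuousAt (fun a => (⟨i.toFun a, u a⟩ : TangentBundle (𝓡 n) M)) a₀)
        (fun j => (i.continuous_diff _).continuousAt) fun j => ht j a₀ hsrc
    have hT₀ : ∀ m, e₀ m = T m a₀ := fun m => by
      simp only [T, joinFrames_apply]
      -- At `a₀` itself `ofChart` and `toChart` are the same coordinate change, the identity.
      exact (eq_joinFrames_iff h _ _ e₀).2 ⟨he₀.1, fun j => (toChart_self _ _).symm⟩ m
    have hbas := eventually_exists_basis hcont T hT e₀ hT₀
    obtain ⟨ε, hε⟩ := (isSignContinuousAt_iff_frame hcont T hT hbas).1 (ho a₀)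
    refine ⟨fun j a => (i.tangent a).mkQ (t j a), ε, ?_⟩
    filter_upwards [hbas, hε, hcont.eventually
      ((chartAt (Euc n) (i.toFun a₀)).open_source.mem_nhds hsrc)] with a ⟨e, he⟩ hea ha
    have he' := he
    simp only [T, joinFrames_apply] at he'
    obtain ⟨h1, h2⟩ := (eq_joinFrames_iff h _ _ e).1 he'
    obtain ⟨c, hc⟩ := exists_adapted_of_basis (i.exact_diff_mkQ a) (Submodule.mkQ_surjective _) h
      (stdBasis k) (i.finrank_normal h a) e h1
    refine ⟨fun j => ⟨t j, ht j a ha, Filter.Eventually.of_forall fun _ => rfl⟩, c, fun j => ?_, ?_⟩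
    · rw [← hc.2 j, h2]
    · have := (hp a).frameSign_eq hc
      rw [hea e he, frameSign_orientation, one_mul] at this
      exact this.symm

/-- Two orientations of the normal bundle that agree at one point are equal. -/
theorem normalOrientation_eq_of_eq_at (h : k + d = n) {ν ν' : i.NormalOrientation d} (a₀ : Euc k)
    (h₀ : ν.orient a₀ = ν'.orient a₀) : ν = ν' := by
  choose o ho using fun a => i.exists_isNormalProduct_right h a (ν.orient a)
  choose o' ho' using fun a => i.exists_isNormalProduct_right h a (ν'.orient a)
  -- The tangential factor is common to both products, so the normal orientations agree at `a`
  -- exactly when the orientations of `TM` do.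
  have hcmp : ∀ a, frameSign (o a) (stdBasis n) * frameSign (o' a) (stdBasis n) =
      frameSign (ν.orient a) (i.normalBasis h a) * frameSign (ν'.orient a) (i.normalBasis h a) :=
    fun a => by
      have := ((ho a).iff_signs (stdBasis k) (i.normalBasis h a) (stdBasis n)).1 (ho' a)
      rwa [Int.units_mul_self, one_mul] at this
  ext a : 2
  refine orientation_ext (i.normalBasis h a) ?_
  have := frameSign_mul_const_of_isSignContinuousAt
    (i.isSignContinuousAt_of_normalOrientation h ν ho)
    (i.isSignContinuousAt_of_normalOrientation h ν' ho') a a₀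
  rw [hcmp, hcmp, h₀, Int.units_mul_self] at this
  exact units_eq_of_mul_eq_one this

/-- An orientation of one normal space extends to an orientation of the normal bundle. -/
theorem exists_normalOrientation (h : k + d = n) (a₀ : Euc k)
    (p₀ : Orientation ℝ (Euc n ⧸ i.tangent a₀) (Fin d)) :
    ∃ ν : i.NormalOrientation d, ν.orient a₀ = p₀ := by
  obtain ⟨oM⟩ := exists_orientation_along (n := n) i.continuous_toFun
  obtain ⟨o₀, ho₀⟩ := i.exists_isNormalProduct_right h a₀ p₀
  have hoM := isSignContinuousAt_of_orientation i.continuous_toFun oM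
  -- One global sign, which corrects `oM` so that it equals the prescribed `o₀` at `a₀`.
  set δ : ℤˣ := frameSign o₀ (stdBasis n) * frameSign (oM.orient a₀) (stdBasis n) with hδ
  choose o ho using fun a =>
    exists_frameSign_eq (stdBasis n) (δ * frameSign (oM.orient a) (stdBasis n))
  choose p hp using fun a => i.exists_isNormalProduct_left h a (o a)
  refine ⟨i.normalOrientationOfSigns h p o hp fun a => ?_, ?_⟩
  · refine ((continuousAt_const (y := δ)).mul (hoM a)).congr
      (Filter.Eventually.of_forall fun b => ?_)
    dsimp only
    rw [ho, mul_assoc]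
    rfl
  · have h1 : o a₀ = o₀ := orientation_ext (stdBasis n) (by
      rw [ho, hδ, mul_assoc, Int.units_mul_self, mul_one])
    have hcmp := ((hp a₀).iff_signs (stdBasis k) (i.normalBasis h a₀) (stdBasis n)).1 ho₀
    rw [h1, Int.units_mul_self, Int.units_mul_self, one_mul] at hcmp
    exact orientation_ext (i.normalBasis h a₀) (units_eq_of_mul_eq_one hcmp.symm)

end ImmersedCell

/-! ### Tangent spaces of regular level sets -/

section Regular

variable {V W : Type*} [NormedAddCommGroup V] [NormedSpace ℝ V] [FiniteDimensional ℝ V]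
  [NormedAddCommGroup W] [NormedSpace ℝ W]

/-- A surjective linear map together with a projection to its kernel is an isomorphism. -/
theorem exists_equiv_prod_ker (A : V →L[ℝ] W) (hA : Function.Surjective A) :
    ∃ (C : V →L[ℝ] A.toLinearMap.ker) (e : V ≃L[ℝ] W × A.toLinearMap.ker),
      (e : V →L[ℝ] W × A.toLinearMap.ker) = A.prod C ∧
        ∀ v : A.toLinearMap.ker, e v = (0, v) := by
  obtain ⟨C, hC⟩ := A.toLinearMap.ker.subtype.exists_leftInverse_of_injective
    (Submodule.ker_subtype _)
  have hCv : ∀ v : A.toLinearMap.ker, C v = v := fun v => LinearMap.congr_fun hC v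
  have hbij : Function.Bijective (A.toLinearMap.prod C) := by
    constructor
    · refine (injective_iff_map_eq_zero _).2 fun v hv => ?_
      obtain ⟨h1, h2⟩ := Prod.ext_iff.1 hv
      have h3 := hCv ⟨v, h1⟩
      exact congrArg Subtype.val (h3.symm.trans h2)
    · rintro ⟨w, u⟩
      obtain ⟨v, rfl⟩ := hA w
      refine ⟨v + ((u - C v : A.toLinearMap.ker) : V), Prod.ext ?_ ?_⟩
      · have : A ((u - C v : A.toLinearMap.ker) : V) = 0 := (u - C v).2
        simp [-AddSubgroupClass.coe_sub, this]
      · have : C (v + ((u - C v : A.toLinearMap.ker) : V)) = u := by rw [map_add, hCv]; abel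
        exact this
  refine ⟨LinearMap.toContinuousLinearMap C,
    (LinearEquiv.ofBijective _ hbij).toContinuousLinearEquiv, ?_, fun v => ?_⟩
  · ext v <;> rfl
  · exact Prod.ext v.2 (hCv v)

/-- The tangent space at `q` of a set that is, near `q`, a regular level set. -/
theorem tangentAt_eq_ker {S : Set V} {q : V} {F : V → W} {A : V →L[ℝ] W}
    (hF : ContDiffAt ℝ ∞ F q) (hA : HasFDerivAt F A q) (hsurj : Function.Surjective A)
    (hS : ∀ᶠ z in 𝓝 q, z ∈ S ↔ F z = F q) : tangentAt S q = A.toLinearMap.ker := by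
  apply le_antisymm
  -- Along a curve in the level set `F` is constant, so `A` kills its velocity.
  · refine Submodule.span_le.2 ?_
    rintro v ⟨c, hc, hcS, hcq, rfl⟩
    have hd : HasDerivAt c (deriv c 0) 0 := (hc.differentiableAt (by simp)).hasDerivAt
    have h1 : HasDerivAt (F ∘ c) (A (deriv c 0)) 0 := by
      rw [← hcq] at hA
      exact hA.comp_hasDerivAt 0 hd
    have hct : Filter.Tendsto c (𝓝 0) (𝓝 q) := by
      have := hc.continuousAt.tendsto
      rwa [hcq] at this
    have h2 : F ∘ c =ᶠ[𝓝 0] fun _ => F q := by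
      filter_upwards [hcS, hct.eventually hS] with t h1 h2 using h2.1 h1
    exact h1.unique ((hasDerivAt_const (0 : ℝ) (F q)).congr_of_eventuallyEq h2)
  -- Conversely, `z ↦ (F z, C z)` is a local diffeomorphism that straightens the level set; the
  -- inverse image of the line in the direction `(0, v)` is a curve in `S` with velocity `v`.
  · intro v hv
    obtain ⟨C, e, he, heK⟩ := exists_equiv_prod_ker A hsurj
    have hG : ContDiffAt ℝ ∞ (fun z => (F z, C z)) q := hF.prodMk C.contDiff.contDiffAt
    have hG' : HasFDerivAt (fun z => (F z, C z)) (e : V →L[ℝ] W × A.toLinearMap.ker) q := by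
      rw [he]
      exact hA.prodMk C.hasFDerivAt
    have hs := hG.hasStrictFDerivAt' hG' (by simp)
    let g := hG.localInverse hG' (by simp)
    have hgq : g (F q, C q) = q := hG.localInverse_apply_image hG' (by simp)
    let ℓ : ℝ → W × A.toLinearMap.ker := fun t => (F q, C q) + t • (0, ⟨v, hv⟩)
    have hℓ0 : ℓ 0 = (F q, C q) := by simp [ℓ]
    have hℓ : ContDiff ℝ ∞ ℓ := contDiff_const.add (contDiff_id.smul contDiff_const)
    have hℓt : Filter.Tendsto ℓ (𝓝 0) (𝓝 (F q, C q)) := by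
      have := hℓ.continuous.tendsto 0
      rwa [hℓ0] at this
    have hcq : (g ∘ ℓ) 0 = q := by rw [Function.comp_apply, hℓ0, hgq]
    have hg : ContDiffAt ℝ ∞ g (ℓ 0) := by
      rw [hℓ0]
      exact hG.to_localInverse hG' (by simp)
    have hcd : ContDiffAt ℝ ∞ (g ∘ ℓ) 0 := hg.comp 0 hℓ.contDiffAt
    have hct : Filter.Tendsto (g ∘ ℓ) (𝓝 0) (𝓝 q) := by
      have := hcd.continuousAt.tendsto
      rwa [hcq] at this
    refine Submodule.subset_span ⟨g ∘ ℓ, hcd, ?_, hcq, ?_⟩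
    · filter_upwards [hℓt.eventually hs.eventually_right_inverse, hct.eventually hS] with t h1 h2
      refine h2.2 ?_
      have := congrArg Prod.fst h1
      exact this.trans (by simp [ℓ])
    · have hgd : HasFDerivAt g (e.symm : W × A.toLinearMap.ker →L[ℝ] V) (ℓ 0) := by
        rw [hℓ0]
        exact hs.to_localInverse.hasFDerivAt
      have hℓd : HasDerivAt ℓ ((0, ⟨v, hv⟩) : W × A.toLinearMap.ker) 0 := by
        have := ((hasDerivAt_id (0 : ℝ)).smul_const
          ((0, ⟨v, hv⟩) : W × A.toLinearMap.ker)).const_add (F q, C q)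
        simpa [ℓ] using this
      have := (hgd.comp_hasDerivAt 0 hℓd).deriv
      rw [this]
      have h3 := heK ⟨v, hv⟩
      exact (e.symm_apply_eq).2 h3.symm

end Regular

/-! ### The tangent space of a transversal intersection -/

namespace ImmersedCell

variable {n : ℕ} {M : Type*} [TopologicalSpace M] [ChartedSpace (Euc n) M]
  {k l : ℕ} {W W' : Set M} (i : ImmersedCell n k W) (j : ImmersedCell n l W')

theorem interDiff_apply (q : i.inter j) (v : Euc k × Euc l) :
    i.interDiff j q v = j.diff (q : Euc k × Euc l).2 v.2 - i.diff (q : Euc k × Euc l).1 v.1 := rfl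

variable {i j} in
theorem Transversal.interDiff_surjective (h : i.Transversal j) (q : i.inter j) :
    Function.Surjective (i.interDiff j q) := by
  intro x
  have hx : x ∈ i.tangent (q : Euc k × Euc l).1 ⊔ j.tangent (q : Euc k × Euc l).2 := by
    rw [h _ _ q.2]
    trivial
  obtain ⟨_, ⟨u, rfl⟩, _, ⟨w, rfl⟩, rfl⟩ := Submodule.mem_sup.1 hx
  exact ⟨(-u, w), by simp [interDiff_apply, add_comm]⟩

/-- This unfolds `mfderiv`, which reads the target in the preferred chart at the image point. Naming
that point `p` lets two cells through it share one chart. -/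
theorem hasFDerivAt_chart {a : Euc k} {p : M} (hp : i.toFun a = p) :
    HasFDerivAt (fun a' => extChartAt (𝓡 n) p (i.toFun a'))
      (LinearMap.toContinuousLinearMap (i.diff a)) a := by
  subst hp
  have h : HasFDerivWithinAt (fun a' => extChartAt (𝓡 n) (i.toFun a) (i.toFun a'))
      (LinearMap.toContinuousLinearMap (i.diff a)) (Set.range (𝓡 k)) a :=
    ((i.smooth a).mdifferentiableAt (by simp)).hasMFDerivAt.2
  rwa [modelWithCornersSelf_coe, Set.range_id, hasFDerivWithinAt_univ] at h

theorem contDiffAt_chart {a : Euc k} {p : M} (hp : i.toFun a = p) :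
    ContDiffAt ℝ ∞ (fun a' => extChartAt (𝓡 n) p (i.toFun a')) a := by
  subst hp
  rw [← contMDiffAt_iff_contDiffAt]
  exact (contMDiffAt_extChartAt (I := 𝓡 n)).comp a (i.smooth a)

/-- The tangent space of a transversal intersection. -/
theorem tangentAt_inter (h : i.Transversal j) (q : i.inter j) :
    tangentAt (i.inter j) (q : Euc k × Euc l) = (i.interDiff j q).ker := by
  obtain ⟨q, hq⟩ := q
  set p := i.toFun q.1 with hp
  have hq' : j.toFun q.2 = p := hq.symm
  have h1 := i.hasFDerivAt_chart hp.symm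
  have h2 := j.hasFDerivAt_chart hq'
  refine tangentAt_eq_ker (F := fun z : Euc k × Euc l =>
      extChartAt (𝓡 n) p (j.toFun z.2) - extChartAt (𝓡 n) p (i.toFun z.1))
    (A := LinearMap.toContinuousLinearMap (i.interDiff j ⟨q, hq⟩)) ?_ ?_
    (h.interDiff_surjective ⟨q, hq⟩) ?_
  · exact ((j.contDiffAt_chart hq').comp q contDiffAt_snd).sub
      ((i.contDiffAt_chart hp.symm).comp q contDiffAt_fst)
  · exact (h2.comp q hasFDerivAt_snd).sub (h1.comp q hasFDerivAt_fst)
  · have hi : ∀ᶠ z in 𝓝 q, i.toFun z.1 ∈ (extChartAt (𝓡 n) p).source :=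
      (i.continuous_toFun.comp continuous_fst).continuousAt.eventually
        (extChartAt_source_mem_nhds (I := 𝓡 n) p)
    have hj : ∀ᶠ z in 𝓝 q, j.toFun z.2 ∈ (extChartAt (𝓡 n) p).source :=
      (j.continuous_toFun.comp continuous_snd).continuousAt.eventually
        (by rw [Function.comp_apply, hq']; exact extChartAt_source_mem_nhds (I := 𝓡 n) p)
    -- Near `q` both points lie in the domain of the chart, which is injective there; so the
    -- difference of their coordinates vanishes exactly on the intersection.
    filter_upwards [hi, hj] with z hzi hzj
    rw [hq', ← hp, sub_self, sub_eq_zero]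
    exact ⟨fun hz => congrArg _ (Eq.symm hz), fun hz => ((extChartAt (𝓡 n) p).injOn hzj hzi hz).symm⟩

end ImmersedCell

/-! ### Orientations of a transversal intersection -/

namespace ImmersedCell

section

variable {n : ℕ} {M : Type*} [TopologicalSpace M] [ChartedSpace (Euc n) M]
  {k l d : ℕ} {W W' : Set M} (i : ImmersedCell n k W) (j : ImmersedCell n l W')

theorem continuous_interMap : Continuous (i.interMap j) :=
  i.continuous_toFun.comp (continuous_fst.comp continuous_subtype_val)

theorem interMap_eq : i.interMap j = fun q : i.inter j => j.toFun (q : Euc k × Euc l).2 :=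
  funext fun q => q.2

variable {i j}

theorem exact_tangentAt_interDiff (h : i.Transversal j) (q : i.inter j) :
    Function.Exact (tangentAt (i.inter j) (q : Euc k × Euc l)).subtype (i.interDiff j q) := by
  rw [LinearMap.exact_iff, Submodule.range_subtype, i.tangentAt_inter j h q]

theorem finrank_tangentAt_inter (h : i.Transversal j) (hd : d + n = k + l) (q : i.inter j) :
    Module.finrank ℝ (tangentAt (i.inter j) (q : Euc k × Euc l)) = d := by
  have h1 := LinearMap.finrank_range_add_finrank_ker (i.interDiff j q)
  rw [LinearMap.range_eq_top.2 (h.interDiff_surjective q), finrank_top, Module.finrank_prod,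
    finrank_euclideanSpace_fin, finrank_euclideanSpace_fin, finrank_euclideanSpace_fin,
    ← i.tangentAt_inter j h q] at h1
  omega

end

variable {n : ℕ} {M : Type*} [TopologicalSpace M] [ChartedSpace (Euc n) M]
  [IsManifold (𝓡 n) ∞ M] {k l d : ℕ} {W W' : Set M} (i : ImmersedCell n k W)
  (j : ImmersedCell n l W')

/-- The differential of the intersection, in the chart at `p₀`. -/
def interDiffChart (p₀ : M) (q : i.inter j) : Euc k × Euc l →L[ℝ] Euc n :=
  (toChart p₀ (i.interMap j q)).comp (LinearMap.toContinuousLinearMap (i.interDiff j q))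

theorem continuousAt_interDiffChart {p₀ : M} {q₀ : i.inter j}
    (h : i.interMap j q₀ ∈ (chartAt (Euc n) p₀).source) :
    ContinuousAt (i.interDiffChart j p₀) q₀ := by
  rw [continuousAt_clm_apply]
  intro v
  have h1 : ContinuousAt (fun q : i.inter j =>
      toChart p₀ (i.interMap j q) (i.diff (q : Euc k × Euc l).1 v.1)) q₀ :=
    ((continuousAt_section_iff (f := i.interMap j) h).1 ((i.continuous_diff v.1).comp
      (continuous_fst.comp continuous_subtype_val)).continuousAt).2
  have h2 : ContinuousAt (fun q : i.inter j =>
      toChart p₀ (i.interMap j q) (j.diff (q : Euc k × Euc l).2 v.2)) q₀ := by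
    rw [i.interMap_eq j] at h ⊢
    exact ((continuousAt_section_iff (f := fun q : i.inter j => j.toFun (q : Euc k × Euc l).2)
      h).1 ((j.continuous_diff v.2).comp
        (continuous_snd.comp continuous_subtype_val)).continuousAt).2
  refine (h2.sub h1).congr (Filter.Eventually.of_forall fun q => ?_)
  exact (map_sub (toChart p₀ (i.interMap j q)) _ _).symm

theorem interDiffChart_eq {p₀ : M} {q : i.inter j}
    (h : i.interMap j q ∈ (chartAt (Euc n) p₀).source) (v : Euc k × Euc l) (w : Euc n) :
    i.interDiffChart j p₀ q v = w ↔ i.interDiff j q v = ofChart p₀ (i.interMap j q) w := by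
  have : i.interDiffChart j p₀ q v = chartEquiv h (i.interDiff j q v) := rfl
  rw [this, ← chartEquiv_symm_apply h, LinearEquiv.eq_symm_apply]

variable {i j}

theorem Transversal.interDiffChart_surjective (h : i.Transversal j) {p₀ : M} {q : i.inter j}
    (hq : i.interMap j q ∈ (chartAt (Euc n) p₀).source) :
    Function.Surjective (i.interDiffChart j p₀ q) :=
  (chartEquiv hq).surjective.comp (h.interDiff_surjective q)

/-- The differential in the chart, completed by a fixed projection `C` to its kernel at `q₀`, is
invertible at `q₀` and hence nearby. Its inverse, applied to constant vectors, gives a frame of the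
moving kernel and lifts of the chart frame. -/
theorem exists_local_frame (h : i.Transversal j) (hd : d + n = k + l) (q₀ : i.inter j) :
    ∃ (v : Fin d → i.inter j → Euc k × Euc l) (w : Fin n → i.inter j → Euc k × Euc l),
      ∀ᶠ q in 𝓝 q₀, (∀ m, ContinuousAt (v m) q) ∧ (∀ m, ContinuousAt (w m) q) ∧
        (∀ m, v m q ∈ tangentAt (i.inter j) (q : Euc k × Euc l)) ∧
        (∀ m, i.interDiff j q (w m q) =
          ofChart (i.interMap j q₀) (i.interMap j q) (stdBasis n m)) ∧
        ∃ b : Module.Basis (Fin (k + l)) ℝ (Euc k × Euc l),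
          ∀ m, b m = joinFrames hd (fun m => v m q) (fun m => w m q) m := by
  set p₀ := i.interMap j q₀ with hp₀
  have hsrc : i.interMap j q₀ ∈ (chartAt (Euc n) p₀).source := mem_chart_source (Euc n) _
  set A₀ := i.interDiffChart j p₀ q₀ with hA₀
  have hsurj : Function.Surjective A₀ := h.interDiffChart_surjective hsrc
  obtain ⟨C, e₀, he₀, -⟩ := exists_equiv_prod_ker A₀ hsurj
  have hfin : Module.finrank ℝ A₀.toLinearMap.ker = d := by
    have h1 := LinearMap.finrank_range_add_finrank_ker A₀.toLinearMap
    rw [LinearMap.range_eq_top.2 hsurj, finrank_top, Module.finrank_prod,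
      finrank_euclideanSpace_fin, finrank_euclideanSpace_fin, finrank_euclideanSpace_fin] at h1
    omega
  let bK : Module.Basis (Fin d) ℝ A₀.toLinearMap.ker := Module.finBasisOfFinrankEq ℝ _ hfin
  let H : i.inter j → (Euc k × Euc l →L[ℝ] Euc n × A₀.toLinearMap.ker) := fun q =>
    (i.interDiffChart j p₀ q).prod C
  have hH : ∀ q, i.interMap j q ∈ (chartAt (Euc n) p₀).source → ContinuousAt H q := fun q hq => by
    have h1 := i.continuousAt_interDiffChart j hq
    rw [continuousAt_clm_apply] at h1 ⊢
    exact fun v => (h1 v).prodMk continuousAt_const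
  have hev : ∀ᶠ q in 𝓝 q₀, i.interMap j q ∈ (chartAt (Euc n) p₀).source :=
    (i.continuous_interMap j).continuousAt.eventually
      ((chartAt (Euc n) p₀).open_source.mem_nhds hsrc)
  have hinv : ∀ᶠ q in 𝓝 q₀, ∃ e : (Euc k × Euc l) ≃L[ℝ] Euc n × A₀.toLinearMap.ker,
      (e : Euc k × Euc l →L[ℝ] Euc n × A₀.toLinearMap.ker) = H q := by
    have := e₀.nhds
    rw [he₀] at this
    exact (hH q₀ hsrc).eventually this
  refine ⟨fun m q => (H q).inverse (0, bK m), fun m q => (H q).inverse (stdBasis n m, 0), ?_⟩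
  filter_upwards [hev, hinv] with q hq ⟨e, he⟩
  have hG : ContinuousAt (fun q => (H q).inverse) q := by
    have h1 := (contDiffAt_map_inverse (𝕜 := ℝ) (n := 0) e).continuousAt
    rw [he] at h1
    exact ContinuousAt.comp (f := H) h1 (hH q hq)
  have hGe : (H q).inverse = (e.symm : Euc n × A₀.toLinearMap.ker →L[ℝ] Euc k × Euc l) := by
    rw [← he, ContinuousLinearMap.inverse_equiv]
  have happ : ∀ z, i.interDiffChart j p₀ q (e.symm z) = z.1 := fun z => by
    have : H q (e.symm z) = z := by rw [← he]; exact e.apply_symm_apply z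
    exact congrArg Prod.fst this
  refine ⟨fun m => hG.clm_apply continuousAt_const, fun m => hG.clm_apply continuousAt_const,
    fun m => ?_, fun m => ?_, ?_⟩
  · rw [i.tangentAt_inter j h q, LinearMap.mem_ker, hGe]
    exact ((i.interDiffChart_eq j hq _ _).1 (happ (0, bK m))).trans (map_zero _)
  · rw [hGe]
    exact (i.interDiffChart_eq j hq _ _).1 (happ (stdBasis n m, 0))
  -- The factors are swapped: the kernel is the second factor of the target of `H`, but its vectors
  -- come first in the frame.
  · have hl : ∀ m, (bK.prod (stdBasis n)).map (LinearEquiv.prodComm ℝ _ _) (Sum.inl m) =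
        (0, bK m) := fun m => by simp
    have hr : ∀ m, (bK.prod (stdBasis n)).map (LinearEquiv.prodComm ℝ _ _) (Sum.inr m) =
        (stdBasis n m, 0) := fun m => by simp
    generalize (bK.prod (stdBasis n)).map (LinearEquiv.prodComm ℝ _ _) = c at hl hr
    refine ⟨(c.map e.symm.toLinearEquiv).reindex (finSumFinEquiv.trans (finCongr hd)), ?_⟩
    rw [eq_joinFrames_iff]
    constructor <;> intro m
    · rw [hGe, ← hl m, Module.Basis.reindex_apply, Module.Basis.map_apply]
      have : (finSumFinEquiv.trans (finCongr hd)).symm (Fin.cast hd (Fin.castAdd n m)) =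
          Sum.inl m := by simp
      rw [this]
      rfl
    · rw [hGe, ← hr m, Module.Basis.reindex_apply, Module.Basis.map_apply]
      have : (finSumFinEquiv.trans (finCongr hd)).symm (Fin.cast hd (Fin.natAdd d m)) =
          Sum.inr m := by simp
      rw [this]
      rfl

/-- An orientation of a transversal intersection from an orientation of `TM` along it. -/
def interOrientationOfSigns (h : i.Transversal j) (hd : d + n = k + l)
    (τ : ∀ q : i.inter j, Orientation ℝ (tangentAt (i.inter j) (q : Euc k × Euc l)) (Fin d))
    (o : i.inter j → Orientation ℝ (Euc n) (Fin n))
    (oE : Orientation ℝ (Euc k × Euc l) (Fin (k + l)))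
    (hτ : ∀ q : i.inter j, IsProductOrientation
      (tangentAt (i.inter j) (q : Euc k × Euc l)).subtype (i.interDiff j q) (τ q) (o q) oE)
    (ho : ∀ q, IsSignContinuousAt (i.interMap j) o q) : SubmanifoldOrientation (i.inter j) d where
  orient := τ
  continuous q₀ := by
    classical
    obtain ⟨v, w, hvw⟩ := exists_local_frame h hd q₀
    obtain ⟨ε, hε⟩ := (ho q₀).exists_frameSign_ofChart (i.continuous_interMap j)
    let g : Module.Basis (Fin (k + l)) ℝ (Euc k × Euc l) :=
      Module.finBasisOfFinrankEq ℝ _ (by simp)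
    -- Since `oE` is constant in `q`, the sign of the whole frame changes only through this
    -- determinant.
    let D : i.inter j → ℝ := fun q => g.det (joinFrames hd (fun m => v m q) fun m => w m q)
    have hD : ContinuousAt D q₀ := by
      refine (continuous_basis_det g).continuousAt.comp (continuousAt_pi.2 fun m => ?_)
      simp only [← joinFrames_apply]
      exact joinFrames_forall hd (P := fun u => ContinuousAt u q₀) hvw.self_of_nhds.1
        hvw.self_of_nhds.2.1 m
    have hD0 : D q₀ ≠ 0 := by
      obtain ⟨b, hb⟩ := hvw.self_of_nhds.2.2.2.2
      have := basis_det_ne_zero g b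
      rwa [funext hb] at this
    obtain ⟨δ, hδ⟩ := continuousAt_units_iff.1
      (ContinuousAt.comp (f := D) (continuousAt_unitSign hD0) hD)
    -- The vectors `v m q` are known to be tangent only near `q₀`; the value `0` elsewhere merely
    -- makes `s` a section.
    let s : Fin d → ∀ q : i.inter j, tangentAt (i.inter j) (q : Euc k × Euc l) := fun m q =>
      if hm : v m q ∈ tangentAt (i.inter j) (q : Euc k × Euc l) then ⟨v m q, hm⟩ else 0
    have hs : ∀ m (q : i.inter j), v m q ∈ tangentAt (i.inter j) (q : Euc k × Euc l) →
        (s m q : Euc k × Euc l) = v m q := fun m q hm => by simp [s, hm]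
    -- This solves the product relation for the sign of the tangent frame: `frameSign oE g * δ` is
    -- the sign of the whole frame, `ε` that of the chart frame.
    refine ⟨s, frameSign oE g * δ * ε, ?_⟩
    filter_upwards [hvw, hvw.eventually_nhds, hε, hδ] with q ⟨hv, hw, hvt, hwd, b, hb⟩ hq
      ⟨hsrc, S, hS, hSε⟩ hqδ
    refine ⟨fun m => (hv m).congr (hq.mono fun q' hq' => (hs m q' (hq'.2.2.1 m)).symm), ?_⟩
    obtain ⟨hb1, hb2⟩ := (eq_joinFrames_iff hd _ _ b).1 hb
    have hli : LinearIndependent ℝ fun m => s m q := by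
      refine LinearIndependent.of_comp (tangentAt (i.inter j) (q : Euc k × Euc l)).subtype ?_
      have := b.linearIndependent.comp (fun m : Fin d => Fin.cast hd (Fin.castAdd n m))
        ((Fin.cast_injective hd).comp (Fin.castAdd_injective d n))
      have hfun : (tangentAt (i.inter j) (q : Euc k × Euc l)).subtype ∘ (fun m => s m q) =
          b ∘ fun m : Fin d => Fin.cast hd (Fin.castAdd n m) :=
        funext fun m => (hs m q (hvt m)).trans (hb1 m).symm
      rw [hfun]
      exact this
    obtain ⟨c, hc⟩ : ∃ c : Module.Basis (Fin d) ℝ (tangentAt (i.inter j) (q : Euc k × Euc l)),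
        ∀ m, c m = s m q := by
      refine ⟨Module.Basis.mk hli ?_, fun m => Module.Basis.mk_apply hli _ m⟩
      exact (hli.span_eq_top_of_card_eq_finrank'
        (by rw [Fintype.card_fin, finrank_tangentAt_inter h hd q])).ge
    refine ⟨c, hc, ?_⟩
    have hadapt : IsAdapted (tangentAt (i.inter j) (q : Euc k × Euc l)).subtype (i.interDiff j q)
        hd c S b := by
      refine ⟨fun m => ?_, fun m => ?_⟩
      · rw [hb1, hc]
        exact (hs m q (hvt m)).symm
      · rw [hb2, hwd, hS]
    have h1 := (hτ q).frameSign_eq hadapt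
    rw [hSε, frameSign_change oE g b, funext hb] at h1
    change frameSign oE g * unitSign (D q) = _ at h1
    change unitSign (D q) = δ at hqδ
    rw [← hqδ, h1, mul_assoc, Int.units_mul_self, mul_one]

end ImmersedCell

/-! ### Signs over trivial bundles and under pullback -/

section Signs

variable {B : Type*} [TopologicalSpace B] {k : ℕ}

/-- The sign of the standard basis with respect to an orientation of a trivial bundle is locally
constant. -/
theorem continuous_frameSign_of_trivial (o : TrivialBundleOrientation B (Euc k) k) :
    Continuous fun b => frameSign (o.orient b) (stdBasis k) := by
  refine continuous_iff_continuousAt.2 fun b₀ => ?_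
  obtain ⟨s, ε, h⟩ := o.continuous b₀
  have hD : ContinuousAt (fun b => (stdBasis k).det fun j => s j b) b₀ :=
    (continuous_basis_det (stdBasis k)).continuousAt.comp (continuousAt_pi.2 h.self_of_nhds.1)
  have hD0 : (stdBasis k).det (fun j => s j b₀) ≠ 0 := by
    obtain ⟨e, he, -⟩ := h.self_of_nhds.2
    have := basis_det_ne_zero (stdBasis k) e
    rwa [funext he] at this
  have hc := ContinuousAt.comp (f := fun b => (stdBasis k).det fun j => s j b)
    (continuousAt_unitSign hD0) hD
  refine ((continuousAt_const (y := ε)).mul hc).congr ?_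
  filter_upwards [h] with b ⟨_, e, he, hε⟩
  have := frameSign_change (o.orient b) (stdBasis k) e
  rw [hε, funext he] at this
  rw [Pi.mul_apply, this, Function.comp_apply, mul_assoc, Int.units_mul_self, mul_one]

/-- An orientation of a trivial bundle from orientations of the fibres with locally constant
signs. -/
def trivialOrientationOfSigns (o : B → Orientation ℝ (Euc k) (Fin k))
    (ho : Continuous fun b => frameSign (o b) (stdBasis k)) :
    TrivialBundleOrientation B (Euc k) k where
  orient := o
  continuous b₀ := by
    obtain ⟨ε, hε⟩ := continuousAt_units_iff.1 (ho.continuousAt (x := b₀))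
    exact ⟨fun j _ => stdBasis k j, ε, hε.mono fun b hb =>
      ⟨fun j => continuousAt_const, stdBasis k, fun j => rfl, hb⟩⟩

/-- The reference chart is the one at `f (g b)` on both sides, so this is plain composition. -/
theorem IsSignContinuousAt.comp {n : ℕ} {M : Type*} [TopologicalSpace M] [ChartedSpace (Euc n) M]
    [IsManifold (𝓡 n) ∞ M] {B' : Type*} [TopologicalSpace B'] {f : B → M}
    {o : B → Orientation ℝ (Euc n) (Fin n)} {g : B' → B} (b : B')
    (ho : IsSignContinuousAt f o (g b)) (hg : ContinuousAt g b) :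
    IsSignContinuousAt (fun b => f (g b)) (fun b => o (g b)) b :=
  ContinuousAt.comp (f := g) ho hg

end Signs

/-! ### Rest points -/

section Dynamics

variable {n : ℕ} {M : Type*} [TopologicalSpace M] [ChartedSpace (Euc n) M]

/-- The characteristic polynomial has degree `n`. This makes the truncated subtraction in the
dimension of the stable manifold a true one. -/
theorem index_le [IsManifold (𝓡 n) ∞ M] (X : ∀ p : M, TangentSpace (𝓡 n) p) (x : M) :
    index X x ≤ n := by
  classical
  unfold index complexEigenvalues
  refine (Multiset.countP_le_card _ _).trans ((Polynomial.card_roots' _).trans ?_)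
  refine Polynomial.natDegree_map_le.trans ?_
  rw [LinearMap.charpoly_natDegree, finrank_euclideanSpace_fin]

theorem mem_unstableSet_self {X : ∀ p : M, TangentSpace (𝓡 n) p} {x : M} (hx : X x = 0) :
    x ∈ unstableSet X x :=
  ⟨fun _ => x, rfl, isMIntegralCurve_const hx, tendsto_const_nhds⟩

theorem mem_stableSet_self {X : ∀ p : M, TangentSpace (𝓡 n) p} {x : M} (hx : X x = 0) :
    x ∈ stableSet X x :=
  ⟨fun _ => x, rfl, isMIntegralCurve_const hx, tendsto_const_nhds⟩

end Dynamics

/-! ### Dimension counts for transversal cells -/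

namespace ImmersedCell

variable {n : ℕ} {M : Type*} [TopologicalSpace M] [ChartedSpace (Euc n) M]
  {k l : ℕ} {W W' : Set M} {i : ImmersedCell n k W} {j : ImmersedCell n l W'}

/-- Where two transversal cells of complementary dimensions meet, the tangent space of the one is
the normal space of the other. -/
theorem Transversal.exists_normalEquiv (h : i.Transversal j) (hd : l + k = n) {a : Euc k}
    {b : Euc l} (hab : i.toFun a = j.toFun b) :
    ∃ e : Euc k ≃ₗ[ℝ] Euc n ⧸ j.tangent b,
      (e : Euc k →ₗ[ℝ] Euc n ⧸ j.tangent b) = (j.tangent b).mkQ ∘ₗ i.diff a := by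
  have hsurj : Function.Surjective ((j.tangent b).mkQ ∘ₗ i.diff a) := by
    intro z
    obtain ⟨z, rfl⟩ := Submodule.mkQ_surjective _ z
    have hz : z ∈ i.tangent a ⊔ j.tangent b := by
      rw [h a b hab]
      trivial
    obtain ⟨_, ⟨u, rfl⟩, w, hw, rfl⟩ := Submodule.mem_sup.1 hz
    refine ⟨u, ?_⟩
    have : (j.tangent b).mkQ w = 0 := by simpa using hw
    rw [map_add, this, add_zero]
    rfl
  have hinj := (LinearMap.injective_iff_surjective_of_finrank_eq_finrank
    (by rw [finrank_euclideanSpace_fin, j.finrank_normal hd])).2 hsurj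
  exact ⟨LinearEquiv.ofBijective _ ⟨hinj, hsurj⟩, rfl⟩

/-- `ℝᵏ × ℝˡ` surjects onto `ℝⁿ` at a common point. For `W⁻ₓ` and `W⁺_y` this gives `i(y) ≤ i(x)`.
-/
theorem Transversal.le_add (h : i.Transversal j) (q : i.inter j) : n ≤ k + l := by
  have h1 := LinearMap.finrank_range_add_finrank_ker (i.interDiff j q)
  rw [LinearMap.range_eq_top.2 (h.interDiff_surjective q), finrank_top, Module.finrank_prod,
    finrank_euclideanSpace_fin, finrank_euclideanSpace_fin, finrank_euclideanSpace_fin] at h1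
  omega

end ImmersedCell

/-! ### The induced orientation and its independence of `o` -/

section Induced

variable {n : ℕ} {M : Type*} [TopologicalSpace M] [ChartedSpace (Euc n) M]
  {k l m d : ℕ} {W W' : Set M} {i : ImmersedCell n k W} {j : ImmersedCell n l W'}

/-- The relation between the orientations of the fibres over a point of the intersection that
defines the induced orientation. -/
def IsInducedAt (i : ImmersedCell n k W) (j : ImmersedCell n l W') (q : i.inter j)
    (ox : Orientation ℝ (Euc k) (Fin k))
    (p : Orientation ℝ (Euc n ⧸ j.tangent (q : Euc k × Euc l).2) (Fin m))
    (o : Orientation ℝ (Euc n) (Fin n))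
    (τ : Orientation ℝ (tangentAt (i.inter j) (q : Euc k × Euc l)) (Fin d))
    (oplus : Orientation ℝ (Euc l) (Fin l)) : Prop :=
  IsProductOrientation (j.diff (q : Euc k × Euc l).2) (j.tangent (q : Euc k × Euc l).2).mkQ
      oplus p o ∧
    ∃ oE : Orientation ℝ (Euc k × Euc l) (Fin (k + l)),
      IsProductOrientation (LinearMap.inl ℝ _ _) (LinearMap.snd ℝ _ _) ox oplus oE ∧
      IsProductOrientation (tangentAt (i.inter j) (q : Euc k × Euc l)).subtype
        (i.interDiff j q) τ o oE

/-- The relation `IsInducedAt` in terms of one reference triple of orientations: it does not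
depend on the orientation of the tangent space of `M`. -/
theorem isInducedAt_iff (h : i.Transversal j) (hm : l + m = n) (hd : d + n = k + l)
    {q : i.inter j} {ox : Orientation ℝ (Euc k) (Fin k)}
    {p : Orientation ℝ (Euc n ⧸ j.tangent (q : Euc k × Euc l).2) (Fin m)}
    {o oN o' : Orientation ℝ (Euc n) (Fin n)}
    {τ τ' : Orientation ℝ (tangentAt (i.inter j) (q : Euc k × Euc l)) (Fin d)}
    {oplus : Orientation ℝ (Euc l) (Fin l)} {oE' : Orientation ℝ (Euc k × Euc l) (Fin (k + l))}
    (hN : j.IsNormalProduct (q : Euc k × Euc l).2 p oN)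
    (hE' : IsProductOrientation (LinearMap.inl ℝ _ _) (LinearMap.snd ℝ _ _)
      (stdBasis k).orientation (stdBasis l).orientation oE')
    (hτ' : IsProductOrientation (tangentAt (i.inter j) (q : Euc k × Euc l)).subtype
      (i.interDiff j q) τ' o' oE')
    (ho' : frameSign o' (stdBasis n) = frameSign ox (stdBasis k) * frameSign oN (stdBasis n)) :
    IsInducedAt i j q ox p o τ oplus ↔
      frameSign oplus (stdBasis l) = frameSign oN (stdBasis n) * frameSign o (stdBasis n) ∧
        τ = τ' := by
  let c := Module.finBasisOfFinrankEq ℝ _ (ImmersedCell.finrank_tangentAt_inter h hd q)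
  let g : Module.Basis (Fin (k + l)) ℝ (Euc k × Euc l) :=
    Module.finBasisOfFinrankEq ℝ _ (by simp)
  -- Compared with the reference product `hN`, the normal factor `p` cancels and the sign of `oplus`
  -- is forced.
  have h1 := hN.iff_signs (p₁ := oplus) (p₂ := p) (p := o) (stdBasis l)
    (j.normalBasis hm (q : Euc k × Euc l).2) (stdBasis n)
  rw [Int.units_mul_self, frameSign_orientation, one_mul, mul_one] at h1
  have h2 : ∀ oE, _ := fun oE => hE'.iff_signs (p₁ := ox) (p₂ := oplus) (p := oE) (stdBasis k)
    (stdBasis l) g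
  have h3 : ∀ oE, _ := fun oE => hτ'.iff_signs (p₁ := τ) (p₂ := o) (p := oE) c (stdBasis n) g
  simp only [frameSign_orientation, one_mul] at h2
  have hττ : τ = τ' ↔ frameSign τ' c = frameSign τ c :=
    ⟨fun e => by rw [e], fun e => orientation_ext c e.symm⟩
  rw [IsInducedAt, h1, hττ, eq_comm]
  refine and_congr_right fun hp => ?_
  constructor
  · rintro ⟨oE, hE, hτE⟩
    have e2 := (h2 oE).1 hE
    have e3 := (h3 oE).1 hτE
    -- The sign of `o` now occurs once on each side, on the left through `oplus`. It cancels, and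
    -- the equality of the signs of `τ'` and `τ` is left as a finite check.
    rw [e2, hp, ho'] at e3
    generalize frameSign ox (stdBasis k) = a at e3
    generalize frameSign oN (stdBasis n) = b at e3
    generalize frameSign o (stdBasis n) = c' at e3
    generalize frameSign τ' c = t' at e3 ⊢
    generalize frameSign τ c = t at e3 ⊢
    revert a b c' t t'
    decide
  · intro ht
    obtain ⟨oE, hE⟩ := exists_frameSign_eq g
      (frameSign oE' g * (frameSign ox (stdBasis k) * frameSign oplus (stdBasis l)))
    refine ⟨oE, (h2 oE).2 ?_, (h3 oE).2 ?_⟩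
    · rw [hE, ← mul_assoc, Int.units_mul_self, one_mul]
    · rw [hE, ← mul_assoc, Int.units_mul_self, one_mul, hp, ht, Int.units_mul_self, ho', one_mul,
        mul_assoc]

variable [IsManifold (𝓡 n) ∞ M]

/-- `T` is orientable along the intersection with a cell. -/
theorem exists_orientation_interMap :
    Nonempty (TangentOrientationAlong (n := n) (i.interMap j)) := by
  -- The intersection need not be connected or simply connected; the orientation is pulled back from
  -- the second cell.
  obtain ⟨oM⟩ := exists_orientation_along (n := n) j.continuous_toFun
  have hg : Continuous fun q : i.inter j => (q : Euc k × Euc l).2 :=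
    continuous_snd.comp continuous_subtype_val
  refine ⟨orientationOfSigns (i.continuous_interMap j)
    (fun q => oM.orient (q : Euc k × Euc l).2) fun q => ?_⟩
  rw [ImmersedCell.interMap_eq]
  exact (isSignContinuousAt_of_orientation j.continuous_toFun oM _).comp q hg.continuousAt

/-- The induced orientation of a transversal intersection exists and is unique. -/
theorem exists_induced_orientation (h : i.Transversal j) (hm : l + m = n) (hd : d + n = k + l)
    (ox : i.CellOrientation) (ν : j.NormalOrientation m) :
    ∃ oxy : SubmanifoldOrientation (i.inter j) d,
      ∀ (o : TangentOrientationAlong (n := n) (i.interMap j))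
        (τ : SubmanifoldOrientation (i.inter j) d),
        (∃ oplus : TrivialBundleOrientation (i.inter j) (Euc l) l, ∀ q : i.inter j,
          IsInducedAt i j q (ox.orient (q : Euc k × Euc l).1) (ν.orient (q : Euc k × Euc l).2)
            (o.orient q) (τ.orient q) (oplus.orient q)) ↔ τ = oxy := by
  choose oN hN using fun a => j.exists_isNormalProduct_right hm a (ν.orient a)
  have hNc := j.isSignContinuousAt_of_normalOrientation hm ν hN
  have hg1 : Continuous fun q : i.inter j => (q : Euc k × Euc l).1 :=
    continuous_fst.comp continuous_subtype_val
  have hg2 : Continuous fun q : i.inter j => (q : Euc k × Euc l).2 :=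
    continuous_snd.comp continuous_subtype_val
  have hNc' : ∀ q : i.inter j,
      IsSignContinuousAt (i.interMap j) (fun q => oN (q : Euc k × Euc l).2) q := fun q => by
    rw [ImmersedCell.interMap_eq]
    exact (hNc _).comp q hg2.continuousAt
  obtain ⟨oE', hE'⟩ := exists_isProductOrientation (LinearMap.inl_injective (R := ℝ))
    (LinearMap.exact_iff.2 (LinearMap.ker_snd ℝ (Euc k) (Euc l)))
    LinearMap.snd_surjective rfl (stdBasis k) (stdBasis l) (stdBasis k).orientation
    (stdBasis l).orientation
  -- With this orientation of `T` the first condition gives `o⁺` the sign of `ox`, so `ox · o⁺` is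
  -- the constant orientation `oE'`, and `τ' · o' = oE'` is the second condition.
  choose o' ho' using fun q : i.inter j => exists_frameSign_eq (stdBasis n)
    (frameSign (ox.orient (q : Euc k × Euc l).1) (stdBasis k) *
      frameSign (oN (q : Euc k × Euc l).2) (stdBasis n))
  choose τ' hτ' using fun q : i.inter j => exists_isProductOrientation_left
    (Submodule.injective_subtype _) (ImmersedCell.exact_tangentAt_interDiff h q)
    (h.interDiff_surjective q) hd
    (Module.finBasisOfFinrankEq ℝ _ (ImmersedCell.finrank_tangentAt_inter h hd q)) (stdBasis n)
    (o' q) oE'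
  have ho'c : ∀ q, IsSignContinuousAt (i.interMap j) o' q := fun q => by
    refine (((continuous_frameSign_of_trivial ox).comp hg1).continuousAt.mul (hNc' q)).congr
      (Filter.Eventually.of_forall fun q' => ?_)
    dsimp only
    rw [ho', mul_assoc]
    rfl
  refine ⟨ImmersedCell.interOrientationOfSigns h hd τ' o' oE' hτ' ho'c, fun o τ => ?_⟩
  have key := fun q oplus => isInducedAt_iff h hm hd (o := o.orient q) (τ := τ.orient q)
    (oplus := oplus) (hN (q : Euc k × Euc l).2) hE' (hτ' q) (ho' q)
  constructor
  · rintro ⟨oplus, hq⟩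
    ext q : 2
    exact ((key q _).1 (hq q)).2
  · rintro rfl
    -- The value forced by the first condition; it is continuous because the chart signs of `oN` and
    -- `o` cancel.
    choose oplus hoplus using fun q : i.inter j => exists_frameSign_eq (stdBasis l)
      (frameSign (oN (q : Euc k × Euc l).2) (stdBasis n) *
        frameSign (o.orient q : Orientation ℝ (Euc n) (Fin n)) (stdBasis n))
    have hc : Continuous fun q => frameSign (oplus q) (stdBasis l) := by
      refine continuous_iff_continuousAt.2 fun q => ((hNc' q).mul
        (isSignContinuousAt_of_orientation (i.continuous_interMap j) o q)).congr
        (Filter.Eventually.of_forall fun q' => ?_)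
      rw [Pi.mul_apply, mul_mul_mul_comm, Int.units_mul_self, mul_one]
      exact (hoplus q').symm
    exact ⟨trivialOrientationOfSigns oplus hc, fun q => (key q _).2 ⟨hoplus q, rfl⟩⟩

end Induced

end MorseSmale

end

/-! ### The theorem -/

theorem proposition7p1 {n : ℕ} {M : Type*} [TopologicalSpace M] [T2Space M]
    [SecondCountableTopology M] [ChartedSpace (MorseSmale.Euc n) M] [IsManifold (𝓡 n) ∞ M]
    (X : ∀ p : M, TangentSpace (𝓡 n) p) (hX : MorseSmale.IsMorseSmale X)
    (x y : M) (hx : X x = 0) (hy : X y = 0) (hxy : MorseSmale.Above X x y)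
    (Wx : MorseSmale.ImmersedCell n (MorseSmale.index X x) (MorseSmale.unstableSet X x))
    (Wy : MorseSmale.ImmersedCell n (MorseSmale.index X y) (MorseSmale.unstableSet X y))
    (Wy' : MorseSmale.ImmersedCell n (n - MorseSmale.index X y) (MorseSmale.stableSet X y))
    (ox : Wx.CellOrientation) (oy : Wy.CellOrientation) :
    Nonempty (MorseSmale.TangentOrientationAlong (n := n) (Wx.interMap Wy')) ∧
      ∃ oxy : MorseSmale.SubmanifoldOrientation (Wx.inter Wy')
          (MorseSmale.index X x - MorseSmale.index X y),
        ∀ (o : MorseSmale.TangentOrientationAlong (n := n) (Wx.interMap Wy'))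
          (oτ : MorseSmale.SubmanifoldOrientation (Wx.inter Wy')
            (MorseSmale.index X x - MorseSmale.index X y)),
          MorseSmale.IsInducedOrientation Wx Wy Wy' ox oy o oτ ↔ oτ = oxy := by
  have hny := MorseSmale.index_le X y
  have hT := hX.transversal x y hx hy Wx Wy'
  -- Transversality for the pair `(y, y)` yields `T_yM = T_yW⁺_y ⊕ T_yW⁻_y`, by which `oy` orients
  -- the normal space at `y`.
  have hTy := hX.transversal y y hy hy Wy Wy'
  have hm : n - MorseSmale.index X y + MorseSmale.index X y = n := Nat.sub_add_cancel hny
  obtain ⟨p, hpx, hpy⟩ := hxy.2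
  rw [← Wx.range_eq] at hpx
  rw [← Wy'.range_eq] at hpy
  obtain ⟨a, ha⟩ := hpx
  obtain ⟨b, hb⟩ := hpy
  -- A connecting trajectory provides the point of intersection needed for `i(y) ≤ i(x)`.
  have hle := hT.le_add ⟨(a, b), ha.trans hb.symm⟩
  have hd : MorseSmale.index X x - MorseSmale.index X y + n =
      MorseSmale.index X x + (n - MorseSmale.index X y) := by omega
  obtain ⟨a₀, ha₀⟩ : y ∈ Set.range Wy.toFun := by
    rw [Wy.range_eq]
    exact MorseSmale.mem_unstableSet_self hy
  obtain ⟨b₀, hb₀⟩ : y ∈ Set.range Wy'.toFun := by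
    rw [Wy'.range_eq]
    exact MorseSmale.mem_stableSet_self hy
  obtain ⟨e, he⟩ := hTy.exists_normalEquiv hm (ha₀.trans hb₀.symm)
  obtain ⟨ν, hν⟩ := Wy'.exists_normalOrientation hm b₀ (Orientation.map _ e (oy.orient a₀))
  obtain ⟨oxy, hoxy⟩ := MorseSmale.exists_induced_orientation hT hm hd ox ν
  refine ⟨MorseSmale.exists_orientation_interMap, oxy, fun o oτ => ?_⟩
  rw [← hoxy o oτ]
  constructor
  · rintro ⟨ν', hν', H⟩
    obtain ⟨e', he', hmap⟩ := hν' a₀ b₀ ha₀ hb₀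
    obtain rfl : e' = e := LinearEquiv.toLinearMap_injective (he'.trans he.symm)
    -- The extension of `oy` to the normal bundle is unique, so the existential over `ν` adds no
    -- freedom.
    obtain rfl : ν' = ν := Wy'.normalOrientation_eq_of_eq_at hm b₀ (hmap.symm.trans hν.symm)
    exact H
  · intro H
    refine ⟨ν, fun a' b' ha' hb' => ?_, H⟩
    -- By injectivity `y` has one parameter on each cell, so the condition at `y` concerns a single
    -- pair.
    obtain rfl : a' = a₀ := Wy.injective (ha'.trans ha₀.symm)
    obtain rfl : b' = b₀ := Wy'.injective (hb'.trans hb₀.symm)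
    exact ⟨e, he, hν.symm⟩
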